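/- All graphs are finite, without loops or parallel edges; $|G|$ denotes the number of vertices of $G$ and $\overline{G}$ its complement. A \emph{hole} in $G$ is an induced cycle of length at least four, and an \emph{antihole} in $G$ of length $\ell$ is an induced subgraph whose complement is a hole of length $\ell$ in $\overline{G}$. A \emph{pure pair} in $G$ is a pair $A,B$ of disjoint subsets of $V(G)$ such that either every vertex of $A$ is adjacent to every vertex of $B$, or no vertex of $A$ is adjacent to a vertex of $B$. Theorem. Let $c>0$ be a real number such that $1/c$ is an integer, and let $\ell_1,\ell_2\ge 4/c+5$ be integers. Then there exists $\varepsilon>0$ such that every graph $G$ with $|G|>1$ that has no hole of length exactly $\ell_1$ and no antihole of length exactly $\ell_2$ has a pure pair $A,B$ with $|A|\ge\varepsilon|G|$ and $|B|\ge\varepsilon|G|^{1-c}$. -/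

import Mathlib

namespace PurePairs

/-- `A` is anticomplete to `B` in `G`: no vertex in `A` has a neighbour in `B`. -/
def IsAnticomplete {V : Type*} (G : SimpleGraph V) (A B : Finset V) : Prop :=
  ∀ a ∈ A, ∀ b ∈ B, ¬ G.Adj a b

/-- A pure pair in `G`: disjoint sets of vertices that are complete or anticomplete. -/
def IsPurePair {V : Type*} (G : SimpleGraph V) (A B : Finset V) : Prop :=
  Disjoint A B ∧ (G.IsCompleteBetween (A : Set V) (B : Set V) ∨ IsAnticomplete G A B)

/-- `G` has a hole of length exactly `l`: an induced subgraph isomorphic to the cycle of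
length `l`, where `l` is at least four. -/
def HasHole {V : Type*} (G : SimpleGraph V) (l : ℕ) : Prop :=
  4 ≤ l ∧ (SimpleGraph.cycleGraph l).IsIndContained G

/-- `G` has an antihole of length exactly `l`: some set of vertices induces a hole of length `l`
in the complement graph. -/
def HasAntihole {V : Type*} (G : SimpleGraph V) (l : ℕ) : Prop :=
  HasHole Gᶜ l

end PurePairs

namespace PurePairs

/-! ### Induced paths and induced cycles -/

section Paths

variable {X : Type*} {G : SimpleGraph X}

/-! Put k = 1/c. A Rödl-type argument (`exists_sparse_or_dense`), which needs only the excluded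
hole, gives a linear-sized set on which G or its complement has small maximum degree.
Complementation exchanges holes with antiholes and complete with anticomplete pairs, so what remains
is a sparse graph with no induced cycle of one length ℓ ≥ 4k+5 (`exists_not_noPair_of_sparse`).

If the sparse statement failed for every ε, there would be ever sparser counterexamples in which
disjoint sets of sizes εn and εn^(1-c) are always joined by an edge. Their ultraproduct is a
`Limit`, where "big" means linear size and the epsilons disappear. Two of its properties drive the
proof. Race: since single vertices have negligible neighbourhoods, a set can be cut down until it
covers a big part of a target and still misses a big part. Expansion: with N = n^(1/k),
neighbourhoods grow by a factor of order N per step, so some vertex has about N^(k-1) descendants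
after k-1 steps through prescribed big sets, and these have neighbours in a big part of every big
set.

In a limit, `Limit.exists_isCycleSeq` joins a vertex v to a big set D by two induced paths. One runs
through an apex set T; the other runs through sets anticomplete to T and has an initial segment that
`Covered.extend` lengthens one vertex at a time, so the total length is adjustable. The distance
from the end of that segment to D is known only up to one (`exists_stable_scale`). In the longer
case both paths end at the same vertex of D; in the shorter case they end at the two ends of an edge
of D with private neighbours (`exists_edge_private`), and the extra edge makes up the difference. -/

/-- A list of vertices forming an induced path. -/
def IndPath (G : SimpleGraph X) : List X → Prop
  | [] => True
  | a :: l => IndPath G l ∧ (∀ b ∈ l.head?, G.Adj a b) ∧ ∀ c ∈ l.tail, ¬ G.Adj a c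

theorem IndPath.cons {a b : X} {l : List X} (h : IndPath G (b :: l)) (hab : G.Adj a b)
    (hl : ∀ c ∈ l, ¬ G.Adj a c) : IndPath G (a :: b :: l) :=
  ⟨h, by simpa using hab, hl⟩

theorem indPath_pair {a b : X} (h : G.Adj a b) : IndPath G [a, b] :=
  IndPath.cons (by simp [IndPath]) h (by simp)

theorem IndPath.append {l₁ l₂ : List X} {x : X} (h₁ : IndPath G (l₁ ++ [x]))
    (h₂ : IndPath G (x :: l₂)) (h : ∀ c ∈ l₁, ∀ d ∈ l₂, ¬ G.Adj c d) :
    IndPath G (l₁ ++ x :: l₂) := by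
  induction l₁ with
  | nil => exact h₂
  | cons a l₁ ih =>
    obtain ⟨h3, h4, h5⟩ := h₁
    refine ⟨ih h3 fun c hc => h c (List.mem_cons_of_mem _ hc), ?_, ?_⟩
    · rcases l₁ with _ | ⟨b, l₁⟩
      · simpa using h4
      · simpa using h4
    · have h6 : ∀ d ∈ l₂, ¬ G.Adj a d := h a List.mem_cons_self
      rcases l₁ with _ | ⟨b, l₁⟩
      · exact h6
      · intro c hc
        have h7 : ∀ c ∈ l₁ ++ [x], ¬ G.Adj a c := h5
        have hc : c ∈ l₁ ++ x :: l₂ := hc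
        simp only [List.mem_append, List.mem_cons] at h7 hc
        grind

theorem IndPath.adj_getD_iff {l : List X} (h : IndPath G l) (v : X) {i j : ℕ} (hij : i < j)
    (hj : j < l.length) : G.Adj (l.getD i v) (l.getD j v) ↔ j = i + 1 := by
  induction l generalizing i j with
  | nil => simp at hj
  | cons a l ih =>
    obtain ⟨h1, h2, h3⟩ := h
    obtain ⟨j, rfl⟩ : ∃ j', j = j' + 1 := ⟨j - 1, by omega⟩
    have hj' : j < l.length := by simpa using hj
    rcases i with _ | i
    · rcases l with _ | ⟨b, l⟩
      · simp at hj'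
      · rcases j with _ | j
        · simpa using h2
        · have hj2 : j < l.length := by simpa using hj'
          have := h3 l[j] (by simp)
          simpa [hj2] using this
    · simpa using ih h1 (by omega) hj'

/-- Vertices `f 0, …, f (l - 1)` forming an induced cycle in this cyclic order. -/
def IsCycleSeq (G : SimpleGraph X) (l : ℕ) (f : ℕ → X) : Prop :=
  ∀ i j, i < j → j < l → (G.Adj (f i) (f j) ↔ j = i + 1 ∨ (i = 0 ∧ j + 1 = l))

/-- Two induced paths with a common end `v`, and no edges between them elsewhere except between
their other ends, form an induced cycle. -/
theorem exists_isCycleSeq {a b : List X} {v x y : X} (ha : IndPath G (y :: (a ++ [v])))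
    (hb : IndPath G (x :: (b ++ [v]))) (hyx : G.Adj y x) (hax : ∀ c ∈ a, ¬ G.Adj c x)
    (hyb : ∀ d ∈ b, ¬ G.Adj y d) (hab : ∀ c ∈ a, ∀ d ∈ b, ¬ G.Adj c d) :
    ∃ f, IsCycleSeq G (a.length + b.length + 3) f := by
  set p := y :: (a ++ [v]) with hp
  set q := x :: (b ++ [v]) with hq
  have hpl : p.length = a.length + 2 := by simp [hp]
  have hql : q.length = b.length + 2 := by simp [hq]
  have hpv : p.getD (a.length + 1) v = v := by simp [hp]
  have hqv : q.getD (b.length + 1) v = v := by simp [hq]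
  -- Run along `p` from `y` to `v`, then back along `q` to `x`. The second index starts at
  -- `b.length`, so the copy of `v` in `q` is skipped.
  refine ⟨fun i => if i ≤ a.length + 1 then p.getD i v
    else q.getD (a.length + b.length + 2 - i) v, ?_⟩
  intro i j hij hj
  by_cases hja : j ≤ a.length + 1
  · have hia : i ≤ a.length + 1 := by omega
    simp only [hja, hia, if_true]
    rw [ha.adj_getD_iff v hij (by omega)]
    omega
  by_cases hia : i ≤ a.length + 1
  · simp only [hja, hia, if_true, if_false]
    by_cases hi : i = a.length + 1
    · subst hi
      have h := hb.adj_getD_iff v (i := a.length + b.length + 2 - j) (j := b.length + 1)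
        (by omega) (by omega)
      rw [hqv] at h
      rw [hpv, G.adj_comm, h]
      omega
    · have key : G.Adj (p.getD i v) (q.getD (a.length + b.length + 2 - j) v) ↔
          (i = 0 ∧ a.length + b.length + 2 - j = 0) := by
        generalize hm : a.length + b.length + 2 - j = m
        have hmb : m ≤ b.length := by omega
        have hia' : i ≤ a.length := by omega
        rcases i with _ | i <;> rcases m with _ | m
        · simpa [hp, hq] using hyx
        · have hmb' : m < b.length := by omega
          have := hyb b[m] (by simp)
          simpa [hp, hq, hmb', List.getElem?_append_left] using this
        · have hia'' : i < a.length := by omega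
          have := hax a[i] (by simp)
          simpa [hp, hq, hia'', List.getElem?_append_left] using this
        · have hmb' : m < b.length := by omega
          have hia'' : i < a.length := by omega
          have := hab a[i] (by simp) b[m] (by simp)
          simpa [hp, hq, hmb', hia'', List.getElem?_append_left] using this
      rw [key]
      omega
  · simp only [hja, hia, if_false]
    rw [G.adj_comm, hb.adj_getD_iff v (by omega) (by omega)]
    omega

end Paths

/-! ### Neighbourhoods, layers and balls -/

section Balls

variable {X : Type*}

/-- The set of vertices with a neighbour in `S`. -/
def nbhd (G : SimpleGraph X) (S : Set X) : Set X := {z | ∃ y ∈ S, G.Adj y z}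

/-- The layers grown from `S`: each next layer consists of the neighbours of the previous one in
the next set of the sequence. -/
def layer (G : SimpleGraph X) (C : ℕ → Set X) (S : Set X) : ℕ → Set X
  | 0 => S
  | j + 1 => nbhd G (layer G C S j) ∩ C (j + 1)

/-- Vertices reached from `x` by walks of length between `1` and `n` with interior in `F`. -/
def reach (G : SimpleGraph X) (F : Set X) (x : X) : ℕ → Set X
  | 0 => ∅
  | n + 1 => nbhd G {x} ∪ nbhd G (reach G F x n ∩ F)

variable {G : SimpleGraph X} {F F' S S' : Set X} {x y z : X} {m n : ℕ}

theorem nbhd_mono (h : S ⊆ S') : nbhd G S ⊆ nbhd G S' :=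
  fun _ ⟨y, hy, hyz⟩ => ⟨y, h hy, hyz⟩

theorem nbhd_union (A B : Set X) : nbhd G (A ∪ B) = nbhd G A ∪ nbhd G B := by
  ext z
  simp only [nbhd, Set.mem_ofPred_eq, Set.mem_union]
  grind

theorem mem_nbhd_singleton : z ∈ nbhd G {x} ↔ G.Adj x z := by simp [nbhd]

theorem reach_mono_set (h : F ⊆ F') (n : ℕ) : reach G F x n ⊆ reach G F' x n := by
  induction n with
  | zero => exact subset_rfl
  | succ n ih =>
    exact Set.union_subset_union_right _ (nbhd_mono (Set.inter_subset_inter ih h))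

theorem reach_subset_succ (n : ℕ) : reach G F x n ⊆ reach G F x (n + 1) := by
  induction n with
  | zero => simp [reach]
  | succ n ih =>
    exact Set.union_subset_union_right _ (nbhd_mono (Set.inter_subset_inter_left _ ih))

theorem reach_mono (h : m ≤ n) : reach G F x m ⊆ reach G F x n :=
  monotone_nat_of_le_succ (f := reach G F x) reach_subset_succ h

theorem mem_reach_of_adj (h : G.Adj x z) (n : ℕ) : z ∈ reach G F x (n + 1) :=
  Or.inl (mem_nbhd_singleton.2 h)

theorem mem_reach_succ (hy : y ∈ reach G F x n) (hyF : y ∈ F) (h : G.Adj y z) :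
    z ∈ reach G F x (n + 1) := Or.inr ⟨y, ⟨hy, hyF⟩, h⟩

theorem reach_subset_of_adj (hxy : G.Adj x y) (hy : y ∈ F) (n : ℕ) :
    reach G F y n ⊆ reach G F x (n + 1) := by
  induction n with
  | zero => simp [reach]
  | succ n ih =>
    rintro z (hz | ⟨w, ⟨hw, hwF⟩, hwz⟩)
    · exact mem_reach_succ (mem_reach_of_adj hxy n) hy (mem_nbhd_singleton.1 hz)
    · exact mem_reach_succ (ih hw) hwF hwz

theorem nbhd_layer_subset_reach {C : ℕ → Set X} (hC : ∀ i ≤ n, 1 ≤ i → C i ⊆ F) :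
    nbhd G (layer G C {x} n) ⊆ reach G F x (n + 1) := by
  induction n with
  | zero => exact fun z hz => Or.inl hz
  | succ n ih =>
    rintro z ⟨w, ⟨hw, hwC⟩, hwz⟩
    exact mem_reach_succ (ih (fun i hi => hC i (by omega)) hw) (hC _ le_rfl (by omega) hwC) hwz

/-- A vertex at exact distance `n + 1` is joined to `x` by an induced path of that length. -/
theorem exists_indPath_of_reach (hz : z ∈ reach G F x (n + 1)) (hz' : z ∉ reach G F x n) :
    ∃ l : List X, l.length = n ∧ IndPath G (z :: (l ++ [x])) ∧ ∀ c ∈ l, c ∈ reach G F x n ∩ F := by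
  induction n generalizing z with
  | zero =>
    rcases hz with hz | hz
    · exact ⟨[], rfl, indPath_pair (mem_nbhd_singleton.1 hz).symm, by simp⟩
    · simp [reach, nbhd] at hz
  | succ n ih =>
    rcases hz with hz | ⟨w, ⟨hw, hwF⟩, hwz⟩
    · exact (hz' (Or.inl hz)).elim
    have hw' : w ∉ reach G F x n := fun h => hz' (mem_reach_succ h hwF hwz)
    obtain ⟨l, hl, hp, hlF⟩ := ih hw hw'
    refine ⟨w :: l, by simp [hl], ?_, ?_⟩
    · refine IndPath.cons hp hwz.symm fun c hc hzc => ?_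
      rcases List.mem_append.1 hc with hc | hc
      · exact hz' (mem_reach_succ (hlF c hc).1 (hlF c hc).2 hzc.symm)
      · rw [List.mem_singleton.1 hc] at hzc
        exact hz' (mem_reach_of_adj hzc.symm n)
    · intro c hc
      rcases List.mem_cons.1 hc with rfl | hc
      · exact ⟨hw, hwF⟩
      · exact ⟨reach_subset_succ _ (hlF c hc).1, (hlF c hc).2⟩

/-- An adjacency would prolong a walk of length at most n by one step. Hence a path to one vertex of
a sphere, apart from its last interior vertex, has no edges to any other vertex of that sphere. -/
theorem not_adj_of_notMem_reach {l : List X} (hl : ∀ c ∈ l, c ∈ reach G F x n ∩ F)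
    (hz : z ∉ reach G F x (n + 1)) : ∀ c ∈ l ++ [x], ¬ G.Adj z c := by
  intro c hc hzc
  rcases List.mem_append.1 hc with hc | hc
  · exact hz (mem_reach_succ (hl c hc).1 (hl c hc).2 hzc.symm)
  · rw [List.mem_singleton.1 hc] at hzc
    exact hz (mem_reach_of_adj hzc.symm n)

theorem exists_indPath_via {w : X} (hz : z ∉ reach G F x (n + 1)) (hw : w ∈ reach G F x (n + 1))
    (hwF : w ∈ F) (hwz : G.Adj w z) :
    ∃ l : List X, l.length = n ∧ IndPath G (w :: (l ++ [x])) ∧ (∀ c ∈ l ++ [x], ¬ G.Adj z c) ∧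
      ∀ c ∈ l, c ∈ reach G F x n ∩ F := by
  obtain ⟨l, hl, hp, hlF⟩ := exists_indPath_of_reach hw fun h => hz (mem_reach_succ h hwF hwz)
  exact ⟨l, hl, hp, not_adj_of_notMem_reach hlF hz, hlF⟩

theorem mem_nbhd_of_mem_reach (hz : z ∈ reach G F x (n + 2)) (hz' : z ∉ reach G F x (n + 1)) :
    z ∈ nbhd G (reach G F x (n + 1) ∩ F) :=
  hz.resolve_left fun h => hz' (Or.inl h)

end Balls

/-! ### Limits of coherent sparse graphs -/

/-- A limit of sparse graphs without large anticomplete pairs: a graph with a notion of internal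
sets, and of big (that is, linear-sized) internal sets. -/
structure Limit {X : Type*} (G : SimpleGraph X) (k : ℕ) where
  /-- Internal sets. -/
  Int : Set X → Prop
  /-- Internal sets of linear size. -/
  Big : Set X → Prop
  int_of_big : ∀ {A}, Big A → Int A
  int_inter : ∀ {A B}, Int A → Int B → Int (A ∩ B)
  int_union : ∀ {A B}, Int A → Int B → Int (A ∪ B)
  int_diff : ∀ {A B}, Int A → Int B → Int (A \ B)
  int_nbhd : ∀ {A}, Int A → Int (nbhd G A)
  int_nbhd_singleton : ∀ x, Int (nbhd G {x})
  big_mono : ∀ {A B}, Big A → Int B → A ⊆ B → Big B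
  big_or : ∀ {A B}, Int A → Int B → Big (A ∪ B) → Big A ∨ Big B
  big_univ : Big Set.univ
  big_split : ∀ {A}, Big A → ∃ B C, Big B ∧ Big C ∧ Disjoint B C ∧ B ⊆ A ∧ C ⊆ A
  not_big_nbhd : ∀ x, ¬ Big (nbhd G {x})
  big_nbhd_inter : ∀ {A B}, Big A → Big B → Big (nbhd G A ∩ B)
  race : ∀ {A B}, Int A → Big (nbhd G A ∩ B) → Int B →
    ∃ A' ⊆ A, Int A' ∧ Big (B \ nbhd G A') ∧ Big (nbhd G A' ∩ B)
  expand : ∀ C : ℕ → Set X, (∀ i < k, Big (C i)) →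
    (∀ i j, i < j → j < k → Disjoint (C i) (C j)) →
    ∃ x ∈ C 0, ∀ D, Big D → Big (nbhd G (layer G C {x} (k - 1)) ∩ D)

namespace Limit

variable {X : Type*} {G : SimpleGraph X} {k : ℕ} (L : Limit G k)
include L

theorem big_inter_or_diff {A B : Set X} (hA : L.Big A) (hB : L.Int B) :
    L.Big (A ∩ B) ∨ L.Big (A \ B) := by
  have hA' := L.int_of_big hA
  refine L.big_or (L.int_inter hA' hB) (L.int_diff hA' hB) ?_
  rwa [Set.inter_union_sdiff]

theorem big_diff_nbhd {A : Set X} (hA : L.Big A) (x : X) : L.Big (A \ nbhd G {x}) :=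
  (L.big_inter_or_diff hA (L.int_nbhd_singleton x)).resolve_left fun h =>
    L.not_big_nbhd x (L.big_mono h (L.int_nbhd_singleton x) Set.inter_subset_right)

theorem big_not_adj_list {A : Set X} (hA : L.Big A) (l : List X) :
    ∃ B ⊆ A, L.Big B ∧ ∀ z ∈ B, ∀ c ∈ l, ¬ G.Adj c z := by
  induction l with
  | nil => exact ⟨A, subset_rfl, hA, by simp⟩
  | cons a l ih =>
    obtain ⟨B, hBA, hB, h⟩ := ih
    refine ⟨B \ nbhd G {a}, Set.sdiff_subset.trans hBA, L.big_diff_nbhd hB a, ?_⟩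
    intro z hz c hc hcz
    rcases List.mem_cons.1 hc with rfl | hc
    · exact hz.2 (mem_nbhd_singleton.2 hcz)
    · exact h z hz.1 c hc hcz

/-- Sets `F` meeting internal sets in sets with internal neighbourhood. -/
def Nice (F : Set X) : Prop := ∀ Q, L.Int Q → L.Int (nbhd G (Q ∩ F))

theorem nice_of_int {F : Set X} (hF : L.Int F) : L.Nice F :=
  fun _ hQ => L.int_nbhd (L.int_inter hQ hF)

theorem int_empty : L.Int ∅ := by
  simpa using L.int_diff (L.int_of_big L.big_univ) (L.int_of_big L.big_univ)

/-- Singletons are not assumed internal, only their neighbourhoods are. This lets the apex set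
contain its centre while balls through it stay internal. -/
theorem nice_insert {F : Set X} (hF : L.Nice F) (x : X) : L.Nice (insert x F) := by
  intro Q hQ
  by_cases hx : x ∈ Q
  · have : Q ∩ insert x F = {x} ∪ Q ∩ F := by
      ext z; simp only [Set.mem_inter_iff, Set.mem_insert_iff, Set.mem_union,
        Set.mem_singleton_iff]; grind
    rw [this, nbhd_union]
    exact L.int_union (L.int_nbhd_singleton x) (hF Q hQ)
  · have : Q ∩ insert x F = Q ∩ F := by
      ext z; simp only [Set.mem_inter_iff, Set.mem_insert_iff]; grind
    rw [this]
    exact hF Q hQ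

theorem int_reach {F : Set X} (hF : L.Nice F) (x : X) (n : ℕ) : L.Int (reach G F x n) := by
  induction n with
  | zero => exact L.int_empty
  | succ n ih => exact L.int_union (L.int_nbhd_singleton x) (hF _ ih)

/-- A ball meeting `D` in a big set is a smaller ball together with a sphere, and one of the two
parts must be big. So the first radius at which the ball becomes big gives a big sphere. -/
theorem exists_level {F D : Set X} (hF : L.Nice F) (hD : L.Int D) {x : X} {m n : ℕ}
    (hm : ¬ L.Big (reach G F x m ∩ D)) (hn : L.Big (reach G F x n ∩ D)) :
    ∃ j, m ≤ j ∧ j < n ∧ L.Big ((reach G F x (j + 1) \ reach G F x j) ∩ D) := by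
  induction n with
  | zero =>
    exact (hm (L.big_mono hn (L.int_inter (L.int_reach hF x m) hD)
      (Set.inter_subset_inter_left _ (reach_mono (Nat.zero_le m))))).elim
  | succ n ih =>
    by_cases h : L.Big (reach G F x n ∩ D)
    · obtain ⟨j, h1, h2, h3⟩ := ih h
      exact ⟨j, h1, by omega, h3⟩
    · have h1 : m ≤ n := by
        by_contra hlt
        exact hm (L.big_mono hn (L.int_inter (L.int_reach hF x m) hD)
          (Set.inter_subset_inter_left _ (reach_mono (by omega))))
      refine ⟨n, h1, by omega, ?_⟩
      rcases L.big_inter_or_diff hn (L.int_reach hF x n) with h2 | h2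
      · refine (h (L.big_mono h2 (L.int_inter (L.int_reach hF x n) hD) ?_)).elim
        exact fun z hz => ⟨hz.2, hz.1.2⟩
      · refine L.big_mono h2 (L.int_inter (L.int_diff (L.int_reach hF x _)
          (L.int_reach hF x _)) hD) ?_
        exact fun z hz => ⟨⟨hz.1.1, hz.2⟩, hz.1.2⟩

theorem not_big_reach_one {F D : Set X} {x : X} : ¬ L.Big (reach G F x 1 ∩ D) := by
  intro h
  refine L.not_big_nbhd x (L.big_mono h (L.int_nbhd_singleton x) ?_)
  rintro z ⟨hz | hz, -⟩
  · exact hz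
  · simp [reach, nbhd] at hz

theorem exists_split_seq {A : Set X} (hA : L.Big A) (n : ℕ) :
    ∃ C : ℕ → Set X, (∀ i < n, L.Big (C i) ∧ C i ⊆ A) ∧
      ∀ i j, i < j → j < n → Disjoint (C i) (C j) := by
  induction n generalizing A with
  | zero => exact ⟨fun _ => ∅, by simp, by simp⟩
  | succ n ih =>
    obtain ⟨B, B', hB, hB', hd, hBA, hBA'⟩ := L.big_split hA
    obtain ⟨C, hC, hC'⟩ := ih hB'
    refine ⟨fun i => i.casesOn B C, ?_, ?_⟩
    · rintro (_ | i) hi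
      · exact ⟨hB, hBA⟩
      · exact ⟨(hC i (by omega)).1, (hC i (by omega)).2.trans hBA'⟩
    · rintro (_ | i) (_ | j) hij hj
      · omega
      · exact hd.mono_right (hC j (by omega)).2
      · omega
      · exact hC' i j (by omega) (by omega)

/-- Some vertex of `A` reaches a big part of every big set by walks of length at most `k`
through `F`. -/
theorem exists_powerful (hk : 1 ≤ k) {A F : Set X} (hA : L.Big A) (hF : L.Big F)
    (hAF : Disjoint A F) : ∃ y ∈ A, ∀ D, L.Big D → L.Big (reach G F y k ∩ D) := by
  obtain ⟨C, hC, hC'⟩ := L.exists_split_seq hF k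
  obtain ⟨y, hy, h⟩ := L.expand (fun i => i.casesOn A C) (by
    rintro (_ | i) hi
    · exact hA
    · exact (hC i (by omega)).1) (by
    rintro (_ | i) (_ | j) hij hj
    · omega
    · exact hAF.mono_right (hC j (by omega)).2
    · omega
    · exact hC' i j (by omega) (by omega))
  refine ⟨y, hy, fun D hD => L.big_mono (h D hD) (L.int_inter
    (L.int_reach (L.nice_of_int (L.int_of_big hF)) y k) (L.int_of_big hD)) ?_⟩
  refine Set.inter_subset_inter_left _ ?_
  obtain ⟨m, rfl⟩ : ∃ m, k = m + 1 := ⟨k - 1, by omega⟩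
  refine nbhd_layer_subset_reach ?_
  rintro (_ | i) hi hi'
  · omega
  · exact (hC i (by omega)).2

/-- A chain of big sets such that each vertex of an earlier set has a neighbour in `A` which is
not a neighbour of a given vertex of a later set. -/
theorem exists_chain {A B : Set X} (hA : L.Int A) (hB : L.Big B) (hAB : B ⊆ nbhd G A) (n : ℕ) :
    ∃ C : ℕ → Set X, (∀ i < n, L.Big (C i) ∧ C i ⊆ B) ∧
      ∀ i j, i < j → j < n → ∀ y ∈ C i, ∀ x ∈ C j, ∃ w ∈ A, G.Adj w y ∧ ¬ G.Adj w x := by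
  induction n generalizing B with
  | zero => exact ⟨fun _ => ∅, by simp, by simp⟩
  | succ n ih =>
    -- The part of `B` covered by `A'` is the first set of the chain; all later sets lie in the part
    -- that `A'` misses.
    obtain ⟨A', hA'A, hA', h1, h2⟩ := L.race hA (by rwa [Set.inter_eq_right.2 hAB])
      (L.int_of_big hB)
    obtain ⟨C, hC, hC'⟩ := ih h1 (Set.sdiff_subset.trans hAB)
    refine ⟨fun i => i.casesOn (nbhd G A' ∩ B) C, ?_, ?_⟩
    · rintro (_ | i) hi
      · exact ⟨h2, Set.inter_subset_right⟩
      · exact ⟨(hC i (by omega)).1, (hC i (by omega)).2.trans Set.sdiff_subset⟩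
    · rintro (_ | i) (_ | j) hij hj y hy x hx
      · omega
      · obtain ⟨w, hw, hwy⟩ := hy.1
        exact ⟨w, hA'A hw, hwy, fun h => ((hC j (by omega)).2 hx).2 ⟨w, hw, h⟩⟩
      · omega
      · exact hC' i j (by omega) (by omega) y hy x hx

/-- If a big set `B` is covered by `A` and by `T`, there is an edge of `B` whose two ends have
private neighbours in `A` and in `T`, respectively. -/
theorem exists_edge_private (hk : 1 ≤ k) {A B T : Set X} (hA : L.Int A) (hB : L.Big B)
    (hAB : B ⊆ nbhd G A) (hT : B ⊆ nbhd G T) :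
    ∃ y ∈ B, ∃ x ∈ B, G.Adj y x ∧ (∃ w ∈ A, G.Adj w y ∧ ¬ G.Adj w x) ∧
      ∃ t ∈ T, G.Adj t x ∧ ¬ G.Adj t y := by
  by_contra! hcon
  obtain ⟨C, hC, hC'⟩ := L.exists_chain hA hB hAB (k + 1)
  -- If no such edge exists, adjacency to a vertex of `T` spreads along edges towards earlier sets.
  -- Starting from one vertex of `C k`, expansion down to `C 0` then makes the neighbourhood of a
  -- single `t` big.
  have up : ∀ i j, i < j → j < k + 1 → ∀ y ∈ C i, ∀ x ∈ C j, G.Adj x y →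
      ∀ t ∈ T, G.Adj t x → G.Adj t y := by
    intro i j hij hj y hy x hx hxy
    exact hcon y ((hC i (by omega)).2 hy) x ((hC j hj).2 hx) hxy.symm
      (hC' i j hij hj y hy x hx)
  obtain ⟨x, hx, h⟩ := L.expand (fun i => C (k - i)) (fun i hi => (hC _ (by omega)).1) (by
    intro i j hij hj
    rw [Set.disjoint_left]
    intro z hz hz'
    obtain ⟨w, -, h1, h2⟩ := hC' (k - j) (k - i) (by omega) (by omega) z hz' z hz
    exact h2 h1)
  have hx' : x ∈ C k := by simpa using hx
  obtain ⟨t, ht, htx⟩ := hT ((hC k (by omega)).2 hx')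
  have hlay : ∀ j, j + 1 ≤ k → ∀ z ∈ layer G (fun i => C (k - i)) {x} j,
      z ∈ C (k - j) ∧ G.Adj t z := by
    intro j
    induction j with
    | zero =>
      intro _ z hz
      obtain rfl : z = x := hz
      exact ⟨hx', htx⟩
    | succ j ih =>
      rintro hj z ⟨⟨u, hu, huz⟩, hz⟩
      obtain ⟨hu1, hu2⟩ := ih (by omega) u hu
      exact ⟨hz, up _ _ (by omega) (by omega) z hz u hu1 huz t ht hu2⟩
  refine L.not_big_nbhd t (L.big_mono (h (C 0) (hC 0 (by omega)).1)
    (L.int_nbhd_singleton t) ?_)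
  rintro z ⟨⟨u, hu, huz⟩, hz⟩
  obtain ⟨hu1, hu2⟩ := hlay (k - 1) (by omega) u hu
  exact mem_nbhd_singleton.2 (up _ _ (by omega) (by omega) z hz u hu1 huz t ht hu2)

/-- A scale at which a big set `D` is first seen from the vertices of a big set `W`. -/
theorem exists_stable_scale (hk : 1 ≤ k) {D F : Set X} (hD : L.Big D) (hF : L.Big F) :
    ∃ n, 1 ≤ n ∧ n + 1 ≤ k ∧ ∃ W ⊆ F, L.Big W ∧
      (∀ x ∈ W, ¬ L.Big (reach G W x n ∩ D)) ∧
      ∀ W' ⊆ W, L.Big W' → ∃ y ∈ W', L.Big (reach G W' y (n + 1) ∩ D) := by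
  classical
  -- `P 1` holds because neighbourhoods of single vertices are not big, and `P n` fails for n ≥ k by
  -- `exists_powerful`. At the first n where `P (n + 1)` fails, the failure speaks of every big
  -- subset of `F`, hence of every big `W' ⊆ W`.
  let P : ℕ → Prop := fun n => ∃ W ⊆ F, L.Big W ∧ ∀ x ∈ W, ¬ L.Big (reach G W x n ∩ D)
  have h1 : P 1 := ⟨F, subset_rfl, hF, fun x _ => L.not_big_reach_one⟩
  have hk' : ∀ n, k ≤ n → ¬ P n := by
    rintro n hn ⟨W, -, hW, h⟩
    obtain ⟨A, B, hA, hB, hd, hAW, hBW⟩ := L.big_split hW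
    obtain ⟨y, hy, hy'⟩ := L.exists_powerful hk hA hB hd
    refine h y (hAW hy) (L.big_mono (hy' D hD) (L.int_inter
      (L.int_reach (L.nice_of_int (L.int_of_big hW)) y n) (L.int_of_big hD)) ?_)
    exact Set.inter_subset_inter_left _ ((reach_mono_set hBW k).trans (reach_mono hn))
  have hex : ∃ n, ¬ P (n + 1) := ⟨k, hk' _ (by omega)⟩
  set n := Nat.find hex with hn
  have hn1 : 1 ≤ n := by
    by_contra h0
    have h0 : n = 0 := by omega
    have := Nat.find_spec hex
    rw [← hn, h0] at this
    exact this h1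
  have hPn : P n := by
    have := Nat.find_min hex (m := n - 1) (by omega)
    rw [not_not, show n - 1 + 1 = n by omega] at this
    exact this
  have hnk : n + 1 ≤ k := by
    by_contra hlt
    exact hk' n (by omega) hPn
  obtain ⟨W, hWF, hW, hWn⟩ := hPn
  refine ⟨n, hn1, hnk, W, hWF, hW, hWn, fun W' hW' hbig => ?_⟩
  have := Nat.find_spec hex
  by_contra! hcon
  exact this ⟨W', hW'.trans hWF, hbig, hcon⟩

end Limit

/-! ### Induced cycles of all large lengths in limits -/

namespace Limit

variable {X : Type*} {G : SimpleGraph X} {k : ℕ} (L : Limit G k)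

/-- Big sets `E` and `F` inside `W`, such that all vertices of `E` are joined to `v` by
induced paths with `p` interior vertices which have no neighbours in `F` and in `T`. -/
structure Covered (T W : Set X) (v : X) (p : ℕ) (E F : Set X) : Prop where
  big_left : L.Big E
  big_right : L.Big F
  left_subset : E ⊆ W
  right_subset : F ⊆ W
  path : ∀ y ∈ E, ∃ l : List X, l.length = p ∧ IndPath G (y :: (l ++ [v])) ∧
    ∀ c ∈ l, (∀ z ∈ F, ¬ G.Adj c z) ∧ ∀ t ∈ T, ¬ G.Adj c t

variable {L}

/-- Race from `E` into `F`: the part of `F` that gets covered becomes the new left set, the missed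
part the new right set, and each path gains its old end as an interior vertex. -/
theorem Covered.extend {T W E F : Set X} {v : X} {p : ℕ} (h : L.Covered T W v p E F)
    (hWT : ∀ z ∈ W, ∀ t ∈ T, ¬ G.Adj z t) (hv : ∀ z ∈ W, ¬ G.Adj v z) :
    ∃ E' F', L.Covered T W v (p + 1) E' F' := by
  obtain ⟨A, hAE, -, h1, h2⟩ := L.race (L.int_of_big h.big_left)
    (L.big_nbhd_inter h.big_left h.big_right) (L.int_of_big h.big_right)
  refine ⟨_, _, h2, h1, Set.inter_subset_right.trans h.right_subset,
    Set.sdiff_subset.trans h.right_subset, ?_⟩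
  · rintro y ⟨⟨z, hzA, hzy⟩, hyF⟩
    obtain ⟨l, hl, hp, hlF⟩ := h.path z (hAE hzA)
    refine ⟨z :: l, by simp [hl], IndPath.cons hp hzy.symm ?_, ?_⟩
    · intro c hc hyc
      rcases List.mem_append.1 hc with hc | hc
      · exact (hlF c hc).1 y hyF hyc.symm
      · rw [List.mem_singleton.1 hc] at hyc
        exact hv y (h.right_subset hyF) hyc.symm
    · intro c hc
      rcases List.mem_cons.1 hc with rfl | hc
      · exact ⟨fun u hu hcu => hu.2 ⟨c, hzA, hcu⟩, hWT c (h.left_subset (hAE hzA))⟩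
      · exact ⟨fun u hu => (hlF c hc).1 u hu.1, (hlF c hc).2⟩

theorem Covered.extend_many {T W E F : Set X} {v : X} {p : ℕ} (h : L.Covered T W v p E F)
    (hWT : ∀ z ∈ W, ∀ t ∈ T, ¬ G.Adj z t) (hv : ∀ z ∈ W, ¬ G.Adj v z) (e : ℕ) :
    ∃ E' F', L.Covered T W v (p + e) E' F' := by
  induction e with
  | zero => exact ⟨E, F, h⟩
  | succ e ih =>
    obtain ⟨E', F', h'⟩ := ih
    exact h'.extend hWT hv

/-- Closing up a cycle through a big set `D` lying on a level of `v` through `T`. -/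
theorem Covered.exists_isCycleSeq (hk : 1 ≤ k) {T W E F D : Set X} {v : X} {p s n : ℕ}
    (h : L.Covered T W v p E F)
    (hWT : ∀ z ∈ W, ∀ t ∈ T, ¬ G.Adj z t) (hv : ∀ z ∈ W, ¬ G.Adj v z)
    (hW : L.Int W) (hD : L.Big D) (hDT : D ⊆ reach G T v (s + 2) \ reach G T v (s + 1))
    (hn : ∀ x ∈ W, ¬ L.Big (reach G W x (n + 1) ∩ D))
    (hn' : ∀ W' ⊆ W, L.Big W' → ∃ y ∈ W', L.Big (reach G W' y (n + 2) ∩ D)) :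
    ∃ f, IsCycleSeq G (n + p + s + 6) f := by
  have hEF := L.big_nbhd_inter h.big_left h.big_right
  have hFnice := L.nice_of_int (L.int_of_big h.big_right)
  have hDint := L.int_of_big hD
  -- The vertex `y` sees much of `D` within n+2 steps, but the path to `v` starts at its neighbour
  -- `x` in `E`. So `x` sees much of `D` within n+3 steps, and by `hn` not within n+1: its big
  -- sphere in `D` has radius n+2 or n+3.
  obtain ⟨y, ⟨⟨x, hxE, hxy⟩, hyF⟩, hy⟩ := hn' _ (Set.inter_subset_right.trans h.right_subset) hEF
  have hx2 : L.Big (reach G F x (n + 3) ∩ D) := by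
    refine L.big_mono hy (L.int_inter (L.int_reach hFnice x _) hDint) ?_
    exact Set.inter_subset_inter_left _
      ((reach_mono_set Set.inter_subset_right _).trans (reach_subset_of_adj hxy hyF _))
  have hx1 : ¬ L.Big (reach G F x (n + 1) ∩ D) := fun hb => by
    refine hn x (h.left_subset hxE) (L.big_mono hb ?_
      (Set.inter_subset_inter_left _ (reach_mono_set h.right_subset _)))
    exact L.int_inter (L.int_reach (L.nice_of_int hW) x _) hDint
  obtain ⟨j, hj1, hj2, hB⟩ := L.exists_level hFnice hDint hx1 hx2
  obtain ⟨i, rfl⟩ : ∃ i, j = i + 1 := ⟨j - 1, by omega⟩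
  obtain ⟨l, hl, hp, hlF⟩ := h.path x hxE
  obtain ⟨B, hBs, hBbig, hBl⟩ := L.big_not_adj_list hB l
  have hxT := hWT x (h.left_subset hxE)
  -- the path from a vertex of `B` to `v` through `F`
  have left : ∀ d ∈ B, ∀ w ∈ reach G F x (i + 1) ∩ F, G.Adj w d →
      ∃ q : List X, q.length = i + p + 1 ∧ IndPath G (d :: (w :: q ++ [v])) ∧
        (∀ c ∈ q, ∀ z ∈ B, ¬ G.Adj c z) ∧ ∀ c ∈ w :: q, ∀ t ∈ T, ¬ G.Adj c t := by
    rintro d hd w ⟨hw, hwF⟩ hwd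
    obtain ⟨q, hq, hqp, -, hqF⟩ := exists_indPath_via (hBs hd).1.2 hw hwF hwd
    have hqB : ∀ z ∈ B, ∀ c ∈ q ++ [x], ¬ G.Adj z c := fun z hz =>
      not_adj_of_notMem_reach hqF (hBs hz).1.2
    have hvd : ∀ z ∈ B, ¬ G.Adj z v := fun z hz hzv =>
      (hDT (hBs hz).2).2 (mem_reach_of_adj hzv.symm _)
    have hpath : IndPath G (w :: q ++ x :: (l ++ [v])) := by
      refine IndPath.append (by simpa using hqp) hp ?_
      intro c hc u hu hcu
      have hcF : c ∈ F := by
        rcases List.mem_cons.1 hc with rfl | hc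
        · exact hwF
        · exact (hqF c hc).2
      rcases List.mem_append.1 hu with hu | hu
      · exact (hlF u hu).1 c hcF hcu.symm
      · rw [List.mem_singleton.1 hu] at hcu
        exact hv c (h.right_subset hcF) hcu.symm
    refine ⟨q ++ x :: l, by simp [hq, hl]; omega, ?_, ?_, ?_⟩
    · have := IndPath.cons (a := d) (b := w) (l := q ++ x :: (l ++ [v])) hpath hwd.symm ?_
      · simpa using this
      · intro c hc hdc
        have hc : c ∈ q ++ [x] ∨ c ∈ l ∨ c = v := by simpa [or_assoc] using hc
        rcases hc with hc | hc | rfl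
        · exact hqB d hd c hc hdc
        · exact hBl d hd c hc hdc.symm
        · exact hvd d hd hdc
    · intro c hc z hz hcz
      have hc : c ∈ q ++ [x] ∨ c ∈ l := by simpa [or_assoc] using hc
      rcases hc with hc | hc
      · exact hqB z hz c hc hcz.symm
      · exact hBl z hz c hc hcz
    · intro c hc
      have hc : c = w ∨ c ∈ q ∨ c = x ∨ c ∈ l := by simpa using hc
      rcases hc with rfl | hc | rfl | hc
      · exact hWT c (h.right_subset hwF)
      · exact hWT c (h.right_subset (hqF c hc).2)
      · exact hxT
      · exact (hlF c hc).2
  -- the path from a vertex of `B` to `v` through `T`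
  have right : ∀ d ∈ B, ∀ t ∈ reach G T v (s + 1) ∩ T, G.Adj t d →
      ∃ r : List X, r.length = s ∧ IndPath G (t :: (r ++ [v])) ∧
        (∀ z ∈ B, ∀ c ∈ r ++ [v], ¬ G.Adj z c) ∧ ∀ c ∈ r, c ∈ T := by
    rintro d hd t ⟨ht, htT⟩ htd
    obtain ⟨r, hr, hrp, -, hrT⟩ := exists_indPath_via (hDT (hBs hd).2).2 ht htT htd
    exact ⟨r, hr, hrp, fun z hz => not_adj_of_notMem_reach hrT (hDT (hBs hz).2).2,
      fun c hc => (hrT c hc).2⟩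
  have coverF : ∀ d ∈ B, d ∈ nbhd G (reach G F x (i + 1) ∩ F) := fun d hd =>
    mem_nbhd_of_mem_reach (hBs hd).1.1 (hBs hd).1.2
  have coverT : ∀ d ∈ B, d ∈ nbhd G (reach G T v (s + 1) ∩ T) := fun d hd =>
    mem_nbhd_of_mem_reach (hDT (hBs hd).2).1 (hDT (hBs hd).2).2
  -- For i = n the path through `F` is one shorter, and the two paths are closed by an edge inside
  -- `B` instead of a common end there. Both cases give length n+p+s+6.
  obtain rfl | rfl : i = n ∨ i = n + 1 := by omega
  · obtain ⟨y, hy, z, hz, hyz, ⟨w, hw, hwy, hwz⟩, t, ht, htz, hty⟩ := L.exists_edge_private hk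
      (L.int_inter (L.int_reach hFnice x _) (L.int_of_big h.big_right)) hBbig coverF coverT
    obtain ⟨q, hq, hqp, hqB, hqT⟩ := left y hy w hw hwy
    obtain ⟨r, hr, hrp, hrB, hrT⟩ := right z hz t ht htz
    have hrT' : ∀ c ∈ t :: r, c ∈ T := by
      intro c hc
      rcases List.mem_cons.1 hc with rfl | hc
      · exact ht.2
      · exact hrT c hc
    have := PurePairs.exists_isCycleSeq (a := w :: q) (b := t :: r) (v := v) (x := z) (y := y) hqp
      (IndPath.cons hrp htz.symm (hrB z hz)) hyz ?_ ?_ fun c hc d hd => hqT c hc d (hrT' d hd)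
    · rw [List.length_cons, List.length_cons, hq, hr] at this
      convert this using 3
      omega
    · intro c hc hcz
      rcases List.mem_cons.1 hc with rfl | hc
      · exact hwz hcz
      · exact hqB c hc z hz hcz
    · intro c hc hyc
      rcases List.mem_cons.1 hc with rfl | hc
      · exact hty hyc.symm
      · exact hrB y hy c (List.mem_append_left _ hc) hyc
  · obtain ⟨d, hd⟩ : B.Nonempty := by
      by_contra hB0
      rw [Set.not_nonempty_iff_eq_empty.1 hB0] at hBbig
      exact L.not_big_nbhd x (L.big_mono hBbig (L.int_nbhd_singleton x) (Set.empty_subset _))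
    obtain ⟨w, hw, hwd⟩ := coverF d hd
    obtain ⟨t, ht, htd⟩ := coverT d hd
    obtain ⟨q, hq, hqp, hqB, hqT⟩ := left d hd w hw hwd
    obtain ⟨r, hr, hrp, hrB, hrT⟩ := right d hd t ht htd
    have := PurePairs.exists_isCycleSeq (a := r) (b := w :: q) (v := v) (x := d) (y := t) hrp
      hqp htd ?_ ?_ ?_
    · rw [List.length_cons, hq, hr] at this
      convert this using 3
      omega
    · exact fun c hc hcd => hrB d hd c (List.mem_append_left _ hc) hcd.symm
    · exact fun c hc htc => hqT c hc t ht.2 htc.symm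
    · exact fun c hc u hu hcu => hqT u hu c (hrT c hc) hcu.symm

end Limit

namespace Limit

variable {X : Type*} {G : SimpleGraph X} {k : ℕ} (L : Limit G k)
include L

/-- Two big sets `M`, `F` and an apex set `T` with no neighbours in `F`, through which all
vertices of `M` are at bounded distance. -/
theorem exists_apex (hk : 1 ≤ k) : ∃ M F T : Set X, L.Big M ∧ L.Big F ∧ L.Nice T ∧
    (∀ z ∈ F, ∀ t ∈ T, ¬ G.Adj z t) ∧ ∀ v ∈ M, M ⊆ reach G T v (2 * k) := by
  obtain ⟨V0, R, hV0, hR, hd0, -, -⟩ := L.big_split L.big_univ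
  obtain ⟨V1, V2, hV1, hV2, hd1, hV1R, hV2R⟩ := L.big_split hR
  obtain ⟨h, -, hh⟩ := L.exists_powerful hk hV0 hV1 (hd0.mono_right hV1R)
  have hnice := L.nice_of_int (L.int_of_big hV1)
  obtain ⟨j, hj1, hjk, hM⟩ := L.exists_level (m := 1) hnice (L.int_of_big hV2)
    L.not_big_reach_one (hh _ hV2)
  obtain ⟨m, rfl⟩ : ∃ m, j = m + 1 := ⟨j - 1, by omega⟩
  set M' := (reach G V1 h (m + 2) \ reach G V1 h (m + 1)) ∩ V2 with hM'
  have hcov : M' ⊆ nbhd G (reach G V1 h (m + 1) ∩ V1) :=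
    fun z hz => mem_nbhd_of_mem_reach hz.1.1 hz.1.2
  have hAint := L.int_inter (L.int_reach hnice h (m + 1)) (L.int_of_big hV1)
  obtain ⟨A, hA, hAi, hF, hMb⟩ := L.race hAint (by rwa [Set.inter_eq_right.2 hcov])
    (L.int_of_big hM)
  -- Vertices of the big set covered by `A` are linked by going through `A` to the centre `h` and
  -- out again, in at most 2(m+2) ≤ 2k steps. The missed part has no neighbours in `T`: it lies
  -- beyond radius m+1 and outside the neighbourhood of `A`.
  set T := insert h ((reach G V1 h m ∩ V1) ∪ A) with hT
  have hhT : h ∈ T := Set.mem_insert _ _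
  have hAT : A ⊆ T := fun z hz => Or.inr (Or.inr hz)
  have hRT : reach G V1 h m ∩ V1 ⊆ T := fun z hz => Or.inr (Or.inl hz)
  have back : ∀ v z i j, z ∈ reach G T v i → z ∈ T → z ∈ reach G V1 h j → j ≤ m + 1 →
      h ∈ reach G T v (i + j) := by
    intro v z i j hz hzT hzj hj
    induction j generalizing z i with
    | zero => exact hzj.elim
    | succ j ih =>
      rcases hzj with hzh | ⟨w, ⟨hw, hwV⟩, hwz⟩
      · exact reach_mono (by omega) (mem_reach_succ hz hzT (mem_nbhd_singleton.1 hzh).symm)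
      · have := ih w (i + 1) (mem_reach_succ hz hzT hwz.symm)
          (hRT ⟨reach_mono (by omega) hw, hwV⟩) hw (by omega)
        exact reach_mono (by omega) this
  have forth : ∀ v i j, h ∈ reach G T v i → j ≤ m + 1 →
      reach G V1 h j ⊆ reach G T v (i + j) := by
    intro v i j hv hj
    induction j with
    | zero => simp [reach]
    | succ j ih =>
      rintro z (hz | ⟨w, ⟨hw, hwV⟩, hwz⟩)
      · exact reach_mono (by omega) (mem_reach_succ hv hhT (mem_nbhd_singleton.1 hz))
      · exact mem_reach_succ (ih (by omega) hw) (hRT ⟨reach_mono (by omega) hw, hwV⟩) hwz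
  refine ⟨_, _, T, hMb, hF, ?_, ?_, ?_⟩
  · exact L.nice_insert (L.nice_of_int (L.int_union (L.int_inter (L.int_reach hnice h m)
      (L.int_of_big hV1)) hAi)) h
  · rintro z ⟨hz, hzA⟩ t (rfl | ht | ht) hzt
    · exact hz.1.2 (mem_reach_of_adj hzt.symm m)
    · exact hz.1.2 (mem_reach_succ ht.1 ht.2 hzt.symm)
    · exact hzA ⟨t, ht, hzt.symm⟩
  · rintro v ⟨⟨a, ha, hav⟩, -⟩ d ⟨⟨b, hb, hbd⟩, -⟩
    have h1 := back v a 1 (m + 1) (mem_reach_of_adj hav.symm 0) (hAT ha) (hA ha).1 le_rfl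
    have h2 := forth v _ (m + 1) h1 le_rfl (hA hb).1
    exact reach_mono (by omega) (mem_reach_succ h2 (hAT hb) hbd)

/-- A first covered pair of sets inside a given big set. -/
theorem exists_covered {A W T F : Set X} {v y : X} (hA : L.Big A) (hW : L.Big W)
    (hAF : A ⊆ F) (hyF : y ∈ F) (hvy : G.Adj v y)
    (hy : L.Big (reach G A y k ∩ W)) (hvA : ∀ z ∈ A, ¬ G.Adj v z) (hvW : ∀ z ∈ W, ¬ G.Adj v z)
    (hT : ∀ z ∈ F, ∀ t ∈ T, ¬ G.Adj z t) :
    ∃ p, p ≤ k ∧ ∃ E F', L.Covered T W v p E F' := by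
  have hnice := L.nice_of_int (L.int_of_big hA)
  obtain ⟨j, hj1, hjk, hE⟩ := L.exists_level (m := 1) hnice (L.int_of_big hW)
    L.not_big_reach_one hy
  obtain ⟨g, rfl⟩ : ∃ g, j = g + 1 := ⟨j - 1, by omega⟩
  have hcov : (reach G A y (g + 2) \ reach G A y (g + 1)) ∩ W ⊆
      nbhd G (reach G A y (g + 1) ∩ A) :=
    fun z hz => mem_nbhd_of_mem_reach hz.1.1 hz.1.2
  obtain ⟨B, hB, -, hF', hEb⟩ := L.race (L.int_inter (L.int_reach hnice y (g + 1))
    (L.int_of_big hA)) (by rwa [Set.inter_eq_right.2 hcov]) (L.int_of_big hE)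
  refine ⟨g + 2, by omega, _, _, hEb, hF',
    Set.inter_subset_right.trans Set.inter_subset_right,
    Set.sdiff_subset.trans Set.inter_subset_right, ?_⟩
  rintro z ⟨⟨b, hb, hbz⟩, hz⟩
  obtain ⟨l, hl, hp, hzl, hlA⟩ := exists_indPath_via hz.1.2 (hB hb).1 (hB hb).2 hbz
  refine ⟨b :: (l ++ [y]), by simp [hl], ?_, ?_⟩
  · have h1 : IndPath G (b :: l ++ y :: [v]) := by
      refine IndPath.append (by simpa using hp) (indPath_pair hvy.symm) ?_
      intro c hc d hd hcd
      rw [List.mem_singleton.1 hd] at hcd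
      rcases List.mem_cons.1 hc with rfl | hc
      · exact hvA c (hB hb).2 hcd.symm
      · exact hvA c (hlA c hc).2 hcd.symm
    have h2 : IndPath G (z :: b :: (l ++ y :: [v])) := by
      refine IndPath.cons h1 hbz.symm ?_
      intro c hc hzc
      have hc : c ∈ l ++ [y] ∨ c = v := by simpa [or_assoc] using hc
      rcases hc with hc | rfl
      · exact hzl c hc hzc
      · exact hvW z hz.2 hzc.symm
    simpa using h2
  · intro c hc
    have hc : c = b ∨ c ∈ l ++ [y] := by simpa using hc
    rcases hc with rfl | hc
    · exact ⟨fun u hu hcu => hu.2 ⟨c, hb, hcu⟩, hT c (hAF (hB hb).2)⟩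
    · refine ⟨fun u hu hcu => not_adj_of_notMem_reach hlA hu.1.1.2 c hc hcu.symm, hT c ?_⟩
      rcases List.mem_append.1 hc with hc | hc
      · exact hAF (hlA c hc).2
      · rwa [List.mem_singleton.1 hc]

/-- A limit contains induced cycles of all large lengths. -/
theorem exists_isCycleSeq (hk : 1 ≤ k) {ℓ : ℕ} (hℓ : 4 * k + 5 ≤ ℓ) :
    ∃ f, IsCycleSeq G ℓ f := by
  obtain ⟨M, F, T, hM, hF, hTn, hFT, hreach⟩ := L.exists_apex hk
  obtain ⟨MA, MB, hMA, hMB, -, hMAM, hMBM⟩ := L.big_split hM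
  obtain ⟨N, hN, -, hF', hE⟩ := L.race (L.int_of_big hMA)
    (L.big_nbhd_inter hMA hF) (L.int_of_big hF)
  obtain ⟨A, Z, hA, hZ, -, hAF, hZF⟩ := L.big_split hF'
  -- It matters that `y` is powerful for all big targets at once: `D` depends on `v`, and `W` on
  -- `D`, and only then is `y` aimed at `W`.
  obtain ⟨y, ⟨⟨v, hv, hvy⟩, hyF⟩, hy⟩ := L.exists_powerful hk hE hA
    (Set.disjoint_left.2 fun z hz hz' => (hAF hz').2 hz.1)
  have hvM := hMAM (hN hv)
  have hvnot : ∀ z ∈ F \ nbhd G N, ¬ G.Adj v z := fun z hz h => hz.2 ⟨v, hv, h⟩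
  obtain ⟨s, hs1, hs2, hD⟩ := L.exists_level (m := 1) (n := 2 * k) (x := v) hTn (L.int_of_big hMB)
    L.not_big_reach_one (by rwa [Set.inter_eq_right.2 (hMBM.trans (hreach v hvM))])
  obtain ⟨s, rfl⟩ : ∃ i, s = i + 1 := ⟨s - 1, by omega⟩
  obtain ⟨n, hn1, hnk, W, hWZ, hW, hWn, hWn'⟩ := L.exists_stable_scale hk hD hZ
  obtain ⟨n, rfl⟩ : ∃ i, n = i + 1 := ⟨n - 1, by omega⟩
  have hWF : W ⊆ F := hWZ.trans (hZF.trans Set.sdiff_subset)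
  have hvW : ∀ z ∈ W, ¬ G.Adj v z := fun z hz => hvnot z (hZF (hWZ hz))
  obtain ⟨p, hp, E', F', hc⟩ := L.exists_covered hA hW (hAF.trans Set.sdiff_subset) hyF hvy
    (hy W hW) (fun z hz => hvnot z (hAF hz)) hvW hFT
  have hWT : ∀ z ∈ W, ∀ t ∈ T, ¬ G.Adj z t := fun z hz => hFT z (hWF hz)
  -- Without extension the cycle has length n+p+s+6 ≤ 4k+2, as n ≤ k-2, p ≤ k and s ≤ 2k-2; the
  -- extension supplies the rest of ℓ.
  obtain ⟨E'', F'', hc'⟩ := hc.extend_many hWT hvW (ℓ - (n + p + s + 6))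
  have := hc'.exists_isCycleSeq hk hWT hvW (L.int_of_big hW) hD Set.inter_subset_left hWn hWn'
  rwa [show n + (p + (ℓ - (n + p + s + 6))) + s + 6 = ℓ by omega] at this

end Limit

/-! ### Expansion in finite graphs without large anticomplete pairs -/

section Expansion

variable {V : Type*} [Finite V] {G : SimpleGraph V}

/-- Any two disjoint sets of size at least `a` and `b` are joined by an edge. -/
def NoPair (G : SimpleGraph V) (a b : ℝ) : Prop :=
  ∀ A B : Set V, Disjoint A B → a ≤ A.ncard → b ≤ B.ncard → ∃ x ∈ A, ∃ y ∈ B, G.Adj x y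

omit [Finite V] in
theorem layer_succ' (C : ℕ → Set V) (S : Set V) (j : ℕ) :
    layer G C S (j + 1) = layer G (fun i => C (i + 1)) (nbhd G S ∩ C 1) j := by
  induction j with
  | zero => rfl
  | succ j ih => rw [layer, ih]; rfl

omit [Finite V] in
theorem layer_mono {C : ℕ → Set V} {S S' : Set V} (h : S ⊆ S') (j : ℕ) :
    layer G C S j ⊆ layer G C S' j := by
  induction j with
  | zero => exact h
  | succ j ih => exact Set.inter_subset_inter_left _ (nbhd_mono ih)

variable {a b : ℝ}

omit [Finite V] in
theorem NoPair.ncard_diff_nbhd_lt (h : NoPair G a b) {A B : Set V} (hAB : Disjoint A B)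
    (hA : b ≤ A.ncard) : ((B \ nbhd G A).ncard : ℝ) < a := by
  by_contra! hlt
  obtain ⟨x, hx, y, hy, hxy⟩ := h (B \ nbhd G A) A
    (hAB.symm.mono_left Set.sdiff_subset) hlt hA
  exact hx.2 ⟨y, hy, hxy.symm⟩

/-- A set of size at least `b` has neighbours almost everywhere. -/
theorem NoPair.le_ncard_nbhd_inter (h : NoPair G a b) (hb : 0 ≤ b) {A B : Set V}
    (hA : b ≤ A.ncard) : (B.ncard : ℝ) - a - b - 1 ≤ (nbhd G A ∩ B).ncard := by
  obtain ⟨S, hSA, hS⟩ := Set.exists_subset_card_eq (s := A) (n := ⌈b⌉₊) (Nat.ceil_le.2 hA)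
  have h1 := h.ncard_diff_nbhd_lt (A := S) (B := B \ S) Set.disjoint_sdiff_right
    (by rw [hS]; exact Nat.le_ceil b)
  have h2 : B ⊆ (nbhd G A ∩ B) ∪ ((B \ S) \ nbhd G S) ∪ S := by
    intro z hz
    by_cases h3 : z ∈ S
    · exact Or.inr h3
    by_cases h4 : z ∈ nbhd G S
    · exact Or.inl (Or.inl ⟨nbhd_mono hSA h4, hz⟩)
    · exact Or.inl (Or.inr ⟨⟨hz, h3⟩, h4⟩)
  have h3 := (Set.ncard_le_ncard h2).trans ((Set.ncard_union_le _ _).trans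
    (Nat.add_le_add_right (Set.ncard_union_le _ _) _))
  have h4 : (S.ncard : ℝ) < b + 1 := by rw [hS]; exact Nat.ceil_lt_add_one hb
  have h5 : (B.ncard : ℝ) ≤ (nbhd G A ∩ B).ncard + ((B \ S) \ nbhd G S).ncard + S.ncard := by
    exact_mod_cast h3
  linarith

/-- Outside a small exceptional set, all sets expand. -/
theorem NoPair.exists_expanding {N m ε θ : ℝ} (hN : 1 ≤ N) (hm : 1 ≤ m) (hε : 0 < ε)
    (hε1 : ε ≤ 1) (hεθ : ε ≤ θ / 2) (h : NoPair G (ε * (N * m)) (ε * m)) {C C' : Set V}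
    (hCC : Disjoint C C') (hC' : θ * (N * m) ≤ C'.ncard) :
    ∃ Z ⊆ C, (Z.ncard : ℝ) < ε * m ∧ ∀ Y ⊆ C \ Z,
      θ / 8 * min (N * Y.ncard) (N * m) ≤ (nbhd G Y ∩ C').ncard := by
  have hθ : 0 < θ := by linarith
  -- `Z` is a largest badly expanding set. It stays below εm, since otherwise it would have
  -- neighbours in almost all of `C'`; a bad set of size at most m outside `Z` could be added to it,
  -- for which the bound 2m leaves room.
  obtain ⟨Z, ⟨hZC, hZm, hZN⟩, hmax⟩ := Set.Finite.exists_maximalFor (fun Z : Set V => Z.ncard)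
    {Z | Z ⊆ C ∧ (Z.ncard : ℝ) ≤ 2 * m ∧ ((nbhd G Z ∩ C').ncard : ℝ) ≤ θ / 4 * N * Z.ncard}
    (Set.toFinite _) ⟨∅, by simp [nbhd]; linarith⟩
  have hZ : (Z.ncard : ℝ) < ε * m := by
    by_contra! hlt
    have h1 := h.ncard_diff_nbhd_lt (hCC.mono_left hZC) hlt
    have h2 := Set.ncard_inter_add_ncard_sdiff_eq_ncard C' (nbhd G Z)
    rw [Set.inter_comm] at h2
    have h3 : ((nbhd G Z ∩ C').ncard : ℝ) + (C' \ nbhd G Z).ncard = C'.ncard := by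
      exact_mod_cast h2
    have h4 : θ / 4 * N * Z.ncard ≤ θ / 4 * N * (2 * m) := by gcongr
    have h5 : ε * (N * m) ≤ θ / 2 * (N * m) := by gcongr
    linarith
  have small : ∀ Y ⊆ C \ Z, (Y.ncard : ℝ) ≤ m → θ / 4 * N * Y.ncard ≤ (nbhd G Y ∩ C').ncard := by
    intro Y hY hYm
    by_contra! hlt
    have hd : Disjoint Z Y := Set.disjoint_left.2 fun z hz hz' => (hY hz').2 hz
    have hcard := Set.ncard_union_eq hd
    have hcard' : ((Z ∪ Y).ncard : ℝ) = Z.ncard + Y.ncard := by exact_mod_cast hcard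
    have hY0 : Y.ncard ≠ 0 := by
      intro h0
      rw [h0] at hlt
      simp only [CharP.cast_eq_zero, mul_zero] at hlt
      exact absurd hlt (not_lt.2 (Nat.cast_nonneg _))
    have h1 : ε * m ≤ 1 * m := by gcongr
    have hle := hmax (j := Z ∪ Y) ⟨Set.union_subset hZC (hY.trans Set.sdiff_subset), by linarith, by
      rw [nbhd_union, Set.union_inter_distrib_right, hcard', mul_add]
      have : (((nbhd G Z ∩ C') ∪ (nbhd G Y ∩ C')).ncard : ℝ) ≤
          (nbhd G Z ∩ C').ncard + (nbhd G Y ∩ C').ncard := by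
        exact_mod_cast Set.ncard_union_le _ _
      linarith⟩ (by simp only; omega)
    simp only at hle
    omega
  refine ⟨Z, hZC, hZ, fun Y hY => ?_⟩
  rcases le_total (Y.ncard : ℝ) m with hYm | hYm
  · refine le_trans ?_ (small Y hY hYm)
    rw [mul_assoc]
    gcongr
    · linarith
    · exact min_le_left _ _
  -- A larger set is replaced by ⌊m⌋ ≥ m/2 of its vertices, which turns θ/4 into θ/8.
  · obtain ⟨S, hSY, hS⟩ := Set.exists_subset_card_eq (s := Y) (n := ⌊m⌋₊)
      (by exact_mod_cast (Nat.floor_le (by linarith)).trans hYm)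
    have h1 : (⌊m⌋₊ : ℝ) ≤ m := Nat.floor_le (by linarith)
    have h2 : m / 2 ≤ ⌊m⌋₊ := by
      have h3 := Nat.lt_floor_add_one m
      have h4 : (1 : ℝ) ≤ ⌊m⌋₊ := by exact_mod_cast Nat.one_le_floor_iff _ |>.2 hm
      linarith
    have h3 := small S (hSY.trans hY) (by rw [hS]; exact h1)
    rw [hS] at h3
    calc θ / 8 * min (N * Y.ncard) (N * m) ≤ θ / 8 * (N * m) := by
          gcongr; exact min_le_right _ _
      _ = θ / 4 * N * (m / 2) := by ring
      _ ≤ θ / 4 * N * ⌊m⌋₊ := by gcongr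
      _ ≤ _ := h3
      _ ≤ _ := by
        exact_mod_cast Set.ncard_le_ncard (Set.inter_subset_inter_left _ (nbhd_mono hSY))

/-- The good sets are built from the last layer backwards: the exceptional part of `C 0` is taken
with respect to the good part `B` of `C 1`, which keeps at least half the guaranteed size; hence
θ/2/8 = θ/16 per step. The cap m reflects that growth is guaranteed only up to that order. -/
theorem NoPair.exists_layers_expanding {N m ε θ : ℝ} (hN : 1 ≤ N) (hm : 1 ≤ m) (hε : 0 < ε)
    (hε1 : ε ≤ 1) (hθ : θ ≤ 1) (hεθ : ε ≤ θ / 4) (h : NoPair G (ε * (N * m)) (ε * m)) (t : ℕ)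
    (C : ℕ → Set V) (hC : ∀ i ≤ t, θ * (N * m) ≤ (C i).ncard)
    (hd : ∀ i j, i < j → j ≤ t → Disjoint (C i) (C j)) :
    ∃ B ⊆ C 0, θ / 2 * (N * m) ≤ B.ncard ∧
      ∀ Y ⊆ B, (θ / 16) ^ t * min (Y.ncard * N ^ t) m ≤ (layer G C Y t).ncard := by
  have hθ0 : 0 < θ := by linarith
  have hN0 : 0 < N := by linarith
  have hm0 : 0 < m := by linarith
  induction t generalizing C with
  | zero =>
    refine ⟨C 0, subset_rfl, ?_, fun Y _ => ?_⟩
    · refine le_trans ?_ (hC 0 le_rfl)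
      gcongr
      linarith
    · simp [layer]
  | succ t ih =>
    obtain ⟨B, hB, hBs, hBY⟩ := ih (fun i => C (i + 1)) (fun i hi => hC _ (by omega))
      (fun i j hij hj => hd _ _ (by omega) (by omega))
    obtain ⟨Z, hZ, hZs, hZY⟩ := NoPair.exists_expanding hN hm hε hε1 (θ := θ / 2) (by linarith) h
      ((hd 0 1 (by omega) (by omega)).mono_right hB) hBs
    refine ⟨C 0 \ Z, Set.sdiff_subset, ?_, fun Y hY => ?_⟩
    · have h1 := Set.ncard_sdiff_add_ncard_of_subset hZ
      have h2 : ((C 0 \ Z).ncard : ℝ) + Z.ncard = (C 0).ncard := by exact_mod_cast h1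
      have h3 := hC 0 (by omega)
      have h4 : ε * m ≤ θ / 4 * (N * m) := by
        have : 1 * m ≤ N * m := by gcongr
        nlinarith
      have : 0 ≤ θ * (N * m) := by positivity
      linarith
    · have h1 := hZY Y hY
      have h2 := hBY (nbhd G Y ∩ B) Set.inter_subset_right
      have h3 : (layer G (fun i => C (i + 1)) (nbhd G Y ∩ B) t).ncard ≤
          (layer G C Y (t + 1)).ncard := by
        rw [layer_succ']
        exact Set.ncard_le_ncard (layer_mono (Set.inter_subset_inter_right _ hB) t)
      refine le_trans ?_ (h2.trans (by exact_mod_cast h3))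
      rw [pow_succ, mul_assoc]
      gcongr
      have hNt : 1 ≤ N ^ t := one_le_pow₀ hN
      have h4 : θ / 16 * min (Y.ncard * N ^ (t + 1)) m ≤
          (θ / 2 / 8 * min (N * Y.ncard) (N * m)) * N ^ t := by
        rw [show θ / 2 / 8 = θ / 16 by ring, mul_assoc]
        gcongr
        rw [min_mul_of_nonneg _ _ (by positivity)]
        refine min_le_min (le_of_eq (by ring)) ?_
        nlinarith [mul_le_mul hN hNt (by norm_num) (by positivity)]
      refine le_min (h4.trans (by gcongr)) ?_
      calc θ / 16 * min (Y.ncard * N ^ (t + 1)) m ≤ θ / 16 * m := by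
            gcongr; exact min_le_right _ _
        _ ≤ 1 * m := by gcongr; linarith
        _ = m := one_mul m

/-- In disjoint linear-sized sets, some vertex of the first has many descendants in the last. -/
theorem NoPair.exists_large_layer {N ε θ : ℝ} {t : ℕ} (hN : 1 ≤ N) (hε : 0 < ε) (hε1 : ε ≤ 1)
    (hθ : θ ≤ 1) (hεθ : ε ≤ θ / 4) (hεt : ε ≤ (θ / 16) ^ t)
    (h : NoPair G (ε * N ^ (t + 1)) (ε * N ^ t)) (C : ℕ → Set V)
    (hC : ∀ i ≤ t, θ * N ^ (t + 1) ≤ (C i).ncard)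
    (hd : ∀ i j, i < j → j ≤ t → Disjoint (C i) (C j)) :
    ∃ x ∈ C 0, ε * N ^ t ≤ (layer G C {x} t).ncard := by
  rw [pow_succ'] at h hC
  have hm : 1 ≤ N ^ t := one_le_pow₀ hN
  obtain ⟨B, hB, hBs, hBY⟩ := h.exists_layers_expanding hN hm hε hε1 hθ hεθ t C hC hd
  have hpos : (0 : ℝ) < B.ncard := lt_of_lt_of_le (by
    have : 0 < θ := by linarith
    positivity) hBs
  obtain ⟨x, hx⟩ := Set.nonempty_of_ncard_ne_zero (s := B) (by
    rintro h0
    simp [h0] at hpos)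
  refine ⟨x, hB hx, ?_⟩
  have h1 := hBY {x} (by simpa using hx)
  rw [Set.ncard_singleton, Nat.cast_one, one_mul, min_self] at h1
  exact le_trans (by gcongr) h1

end Expansion

/-! ### Ultraproducts of coherent sparse graphs -/

section Ultraproduct

open Filter

variable {V : ℕ → Type*} (G : ∀ i, SimpleGraph (V i))

/-- The ultraproduct of a sequence of graphs. -/
def limitGraph : SimpleGraph (∀ i, V i) where
  Adj x y := ∀ᶠ i in hyperfilter ℕ, (G i).Adj (x i) (y i)
  symm := ⟨fun _ _ h => h.mono fun _ hi => hi.symm⟩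
  loopless := ⟨fun x h => by
    obtain ⟨i, hi⟩ := h.exists
    exact (G i).loopless.irrefl _ hi⟩

/-- The internal set given by a sequence of sets. -/
def st (A : ∀ i, Set (V i)) : Set (∀ i, V i) := {x | ∀ᶠ i in hyperfilter ℕ, x i ∈ A i}

variable {G}

theorem st_inter (A B : ∀ i, Set (V i)) : st (fun i => A i ∩ B i) = st A ∩ st B := by
  ext x
  exact eventually_and

theorem st_union (A B : ∀ i, Set (V i)) : st (fun i => A i ∪ B i) = st A ∪ st B := by
  ext x
  exact Ultrafilter.eventually_or

theorem st_diff (A B : ∀ i, Set (V i)) : st (fun i => A i \ B i) = st A \ st B := by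
  ext x
  exact eventually_and.trans (and_congr_right fun _ => Ultrafilter.eventually_not)

theorem st_nbhd_singleton (x : ∀ i, V i) :
    nbhd (limitGraph G) {x} = st fun i => nbhd (G i) {x i} := by
  ext z
  simp only [mem_nbhd_singleton, st, Set.mem_ofPred_eq]
  rfl

variable [∀ i, Nonempty (V i)]

theorem st_subset_iff {A B : ∀ i, Set (V i)} :
    st A ⊆ st B ↔ ∀ᶠ i in hyperfilter ℕ, A i ⊆ B i := by
  refine ⟨fun h => ?_, fun h x hx => ?_⟩
  · by_contra hcon
    have h1 := Ultrafilter.eventually_not.2 hcon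
    have h2 : ∀ i, ∃ x, ¬ A i ⊆ B i → x ∈ A i ∧ x ∉ B i := by
      intro i
      by_cases h3 : A i ⊆ B i
      · exact ⟨Classical.arbitrary _, fun h => (h h3).elim⟩
      · obtain ⟨x, hx⟩ := Set.not_subset.1 h3
        exact ⟨x, fun _ => hx⟩
    choose x hx using h2
    have h4 : x ∈ st B := h (h1.mono fun i hi => (hx i hi).1)
    obtain ⟨i, hi, hi'⟩ := (h1.and h4).exists
    exact (hx i hi).2 hi'
  · filter_upwards [h, hx] with i hi hxi using hi hxi

theorem st_eq_iff {A B : ∀ i, Set (V i)} : st A = st B ↔ ∀ᶠ i in hyperfilter ℕ, A i = B i := by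
  simp only [Set.Subset.antisymm_iff, st_subset_iff, eventually_and]

theorem st_nbhd (A : ∀ i, Set (V i)) :
    st (fun i => nbhd (G i) (A i)) = nbhd (limitGraph G) (st A) := by
  ext z
  constructor
  · intro hz
    have h : ∀ i, ∃ y, z i ∈ nbhd (G i) (A i) → y ∈ A i ∧ (G i).Adj y (z i) := by
      intro i
      by_cases h : z i ∈ nbhd (G i) (A i)
      · obtain ⟨y, hy⟩ := h
        exact ⟨y, fun _ => hy⟩
      · exact ⟨Classical.arbitrary _, fun h' => (h h').elim⟩
    choose y hy using h
    exact ⟨y, hz.mono fun i hi => (hy i hi).1, hz.mono fun i hi => (hy i hi).2⟩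
  · rintro ⟨y, hy, hyz⟩
    filter_upwards [hy, hyz] with i h1 h2 using ⟨y i, h1, h2⟩

/-- The internal sets with linear-sized representatives. -/
def IsBig (S : Set (∀ i, V i)) : Prop :=
  ∃ A, st A = S ∧ ∃ δ : ℝ, 0 < δ ∧ ∀ᶠ i in hyperfilter ℕ, δ * Nat.card (V i) ≤ (A i).ncard

theorem isBig_st {A : ∀ i, Set (V i)} : IsBig (st A) ↔
    ∃ δ : ℝ, 0 < δ ∧ ∀ᶠ i in hyperfilter ℕ, δ * Nat.card (V i) ≤ (A i).ncard := by
  refine ⟨?_, fun h => ⟨A, rfl, h⟩⟩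
  rintro ⟨B, hB, δ, hδ, h⟩
  refine ⟨δ, hδ, ?_⟩
  filter_upwards [h, st_eq_iff.1 hB] with i h1 h2
  rwa [← h2]

variable (G) in
/-- A sequence of ever sparser graphs with ever smaller anticomplete pairs. -/
structure CoherentSeq (t : ℕ) (N : ℕ → ℝ) : Prop where
  one_le : ∀ i, 1 ≤ N i
  card_eq : ∀ i, (Nat.card (V i) : ℝ) = N i ^ (t + 1)
  lt_card : ∀ i, i < Nat.card (V i)
  degree : ∀ i x, ((nbhd (G i) {x}).ncard : ℝ) < 1 / ((i : ℝ) + 1) * Nat.card (V i)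
  noPair : ∀ i, NoPair (G i) (1 / ((i : ℝ) + 1) * N i ^ (t + 1)) (1 / ((i : ℝ) + 1) * N i ^ t)

theorem eventually_inv_le {δ : ℝ} (hδ : 0 < δ) :
    ∀ᶠ i : ℕ in hyperfilter ℕ, 1 / ((i : ℝ) + 1) ≤ δ :=
  Nat.hyperfilter_le_atTop (((tendsto_order.1 tendsto_one_div_add_atTop_nhds_zero_nat).2 δ hδ).mono
    fun _ h => h.le)

namespace CoherentSeq

variable {t : ℕ} {N : ℕ → ℝ} [∀ i, Finite (V i)] (h : CoherentSeq G t N)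
include h

omit [∀ i, Nonempty (V i)] [∀ i, Finite (V i)] in
theorem eventually_one_le {δ : ℝ} (hδ : 0 < δ) :
    ∀ᶠ i : ℕ in hyperfilter ℕ, 1 ≤ δ * Nat.card (V i) := by
  filter_upwards [eventually_inv_le hδ] with i hi
  have h1 : (i : ℝ) + 1 ≤ Nat.card (V i) := by exact_mod_cast h.lt_card i
  have h2 : (0 : ℝ) < (i : ℝ) + 1 := by positivity
  calc (1 : ℝ) = 1 / ((i : ℝ) + 1) * ((i : ℝ) + 1) := by field_simp
    _ ≤ δ * Nat.card (V i) := by gcongr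

-- The set `A` need only have order N^t, not linear size. This gives the final step of expansion
-- into an arbitrary big set.
omit [∀ i, Nonempty (V i)] in
theorem nbhd_inter {A B : ∀ i, Set (V i)} {δ : ℝ} (hδ : 0 < δ)
    (hA : ∀ᶠ i : ℕ in hyperfilter ℕ, 1 / ((i : ℝ) + 1) * N i ^ t ≤ (A i).ncard)
    (hB : ∀ᶠ i in hyperfilter ℕ, δ * Nat.card (V i) ≤ (B i).ncard) :
    ∀ᶠ i in hyperfilter ℕ, δ / 4 * Nat.card (V i) ≤ (nbhd (G i) (A i) ∩ B i).ncard := by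
  filter_upwards [hA, hB, eventually_inv_le (δ := δ / 4) (by positivity),
    h.eventually_one_le (δ := δ / 4) (by positivity)] with i h1 h2 h3 h4
  have h0 := h.one_le i
  have h5 := (h.noPair i).le_ncard_nbhd_inter (B := B i) (by positivity) h1
  have h6 : 1 / ((i : ℝ) + 1) * N i ^ (t + 1) ≤ δ / 4 * Nat.card (V i) := by
    rw [h.card_eq]; gcongr
  have h7 : 1 / ((i : ℝ) + 1) * N i ^ t ≤ 1 / ((i : ℝ) + 1) * N i ^ (t + 1) := by
    gcongr
    omega
  linarith

/-- At each index take a smallest subset covering at least δ/2 of the vertices inside `B`. Without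
one of its vertices it covers less than δ/2, and that vertex adds at most δ/4, so δ/4 is left
uncovered. -/
theorem race {A B : ∀ i, Set (V i)} (hAB : IsBig (nbhd (limitGraph G) (st A) ∩ st B)) :
    ∃ A' ⊆ st A, (∃ A'', st A'' = A') ∧ IsBig (st B \ nbhd (limitGraph G) A') ∧
      IsBig (nbhd (limitGraph G) A' ∩ st B) := by
  rw [← st_nbhd, ← st_inter, isBig_st] at hAB
  obtain ⟨δ, hδ, hAB⟩ := hAB
  have key : ∀ i, ∃ S ⊆ A i, δ * Nat.card (V i) ≤ (nbhd (G i) (A i) ∩ B i).ncard →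
      1 / ((i : ℝ) + 1) ≤ δ / 4 → δ / 2 * Nat.card (V i) ≤ (nbhd (G i) S ∩ B i).ncard ∧
        δ / 4 * Nat.card (V i) ≤ (B i \ nbhd (G i) S).ncard := by
    intro i
    by_cases h1 : δ * Nat.card (V i) ≤ (nbhd (G i) (A i) ∩ B i).ncard
    swap
    · exact ⟨∅, by simp, fun h => (h1 h).elim⟩
    have hn : (0 : ℝ) < Nat.card (V i) := by exact_mod_cast Nat.card_pos
    obtain ⟨S, ⟨hSA, hS⟩, hmin⟩ := Set.Finite.exists_minimalFor (fun S : Set (V i) => S.ncard)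
      {S | S ⊆ A i ∧ δ / 2 * Nat.card (V i) ≤ (nbhd (G i) S ∩ B i).ncard} (Set.toFinite _)
      ⟨A i, subset_rfl, by nlinarith⟩
    refine ⟨S, hSA, fun _ h2 => ⟨hS, ?_⟩⟩
    obtain ⟨s, hs⟩ : S.Nonempty := by
      by_contra h0
      rw [Set.not_nonempty_iff_eq_empty.1 h0] at hS
      simp [nbhd] at hS
      nlinarith
    have h3 : ((nbhd (G i) (S \ {s}) ∩ B i).ncard : ℝ) < δ / 2 * Nat.card (V i) := by
      by_contra! h4
      have h5 := hmin (j := S \ {s}) ⟨Set.sdiff_subset.trans hSA, h4⟩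
        (Set.ncard_le_ncard Set.sdiff_subset)
      have h6 := Set.ncard_sdiff_singleton_lt_of_mem hs
      simp only at h5
      omega
    have h4 : nbhd (G i) S ∩ B i ⊆ (nbhd (G i) (S \ {s}) ∩ B i) ∪ nbhd (G i) {s} := by
      rintro z ⟨⟨y, hy, hyz⟩, hz⟩
      by_cases hys : y = s
      · exact Or.inr (mem_nbhd_singleton.2 (hys ▸ hyz))
      · exact Or.inl ⟨⟨y, ⟨hy, hys⟩, hyz⟩, hz⟩
    have h5 : ((nbhd (G i) S ∩ B i).ncard : ℝ) ≤
        (nbhd (G i) (S \ {s}) ∩ B i).ncard + (nbhd (G i) {s}).ncard := by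
      exact_mod_cast (Set.ncard_le_ncard h4).trans (Set.ncard_union_le _ _)
    have h6 := h.degree i s
    have h7 := Set.ncard_inter_add_ncard_sdiff_eq_ncard (B i) (nbhd (G i) S)
    rw [Set.inter_comm] at h7
    have h8 : ((nbhd (G i) S ∩ B i).ncard : ℝ) + (B i \ nbhd (G i) S).ncard = (B i).ncard := by
      exact_mod_cast h7
    have h9 : ((nbhd (G i) (A i) ∩ B i).ncard : ℝ) ≤ (B i).ncard := by
      exact_mod_cast Set.ncard_le_ncard Set.inter_subset_right
    have h10 : 1 / ((i : ℝ) + 1) * Nat.card (V i) ≤ δ / 4 * Nat.card (V i) := by gcongr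
    linarith
  choose S hSA hS using key
  refine ⟨st S, st_subset_iff.2 (Eventually.of_forall hSA), ⟨S, rfl⟩, ?_, ?_⟩
  · rw [← st_nbhd, ← st_diff, isBig_st]
    refine ⟨δ / 4, by positivity, ?_⟩
    filter_upwards [hAB, eventually_inv_le (δ := δ / 4) (by positivity)] with i h1 h2
      using (hS i h1 h2).2
  · rw [← st_nbhd, ← st_inter, isBig_st]
    refine ⟨δ / 2, by positivity, ?_⟩
    filter_upwards [hAB, eventually_inv_le (δ := δ / 4) (by positivity)] with i h1 h2
      using (hS i h1 h2).1

theorem split {A : ∀ i, Set (V i)} (hA : IsBig (st A)) :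
    ∃ B C : Set (∀ i, V i), IsBig B ∧ IsBig C ∧ Disjoint B C ∧ B ⊆ st A ∧ C ⊆ st A := by
  obtain ⟨δ, hδ, hA⟩ := isBig_st.1 hA
  have key : ∀ i, ∃ S ⊆ A i, S.ncard = (A i).ncard / 2 := fun i =>
    Set.exists_subset_card_eq (Nat.div_le_self _ _)
  choose S hS hcard using key
  refine ⟨st S, st A \ st S, ?_, ?_, Set.disjoint_sdiff_right,
    st_subset_iff.2 (Eventually.of_forall hS), Set.sdiff_subset⟩
  · refine isBig_st.2 ⟨δ / 4, by positivity, ?_⟩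
    filter_upwards [hA, h.eventually_one_le (δ := δ / 2) (by positivity)] with i h1 h2
    have h3 : (A i).ncard ≤ 2 * (S i).ncard + 1 := by rw [hcard]; omega
    have h4 : ((A i).ncard : ℝ) ≤ 2 * (S i).ncard + 1 := by exact_mod_cast h3
    linarith
  · rw [← st_diff]
    refine isBig_st.2 ⟨δ / 4, by positivity, ?_⟩
    filter_upwards [hA] with i h1
    have h2 := Set.ncard_sdiff_add_ncard_of_subset (hS i)
    have h3 : (A i).ncard ≤ 2 * (A i \ S i).ncard := by rw [hcard] at h2; omega
    have h4 : ((A i).ncard : ℝ) ≤ 2 * (A i \ S i).ncard := by exact_mod_cast h3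
    have h5 : (0 : ℝ) ≤ Nat.card (V i) := by positivity
    nlinarith

omit h [∀ i, Finite (V i)] in
theorem nbhd_layer {C : ℕ → Set (∀ i, V i)} {A : ℕ → ∀ i, Set (V i)} {n : ℕ}
    (hA : ∀ j ≤ n, st (A j) = C j) (x : ∀ i, V i) :
    nbhd (limitGraph G) (layer (limitGraph G) C {x} n) =
      st fun i => nbhd (G i) (layer (G i) (fun j => A j i) {x i} n) := by
  induction n with
  | zero => exact st_nbhd_singleton x
  | succ n ih =>
    rw [layer, ih fun j hj => hA j (by omega), ← hA _ le_rfl, ← st_inter, ← st_nbhd]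
    rfl

theorem expand (C : ℕ → Set (∀ i, V i)) (hC : ∀ j < t + 1, IsBig (C j))
    (hd : ∀ i j, i < j → j < t + 1 → Disjoint (C i) (C j)) :
    ∃ x ∈ C 0, ∀ D, IsBig D →
      IsBig (nbhd (limitGraph G) (layer (limitGraph G) C {x} t) ∩ D) := by
  choose! A hAC δ hδ hA using hC
  obtain ⟨θ, hθ, hθ1, hθδ⟩ : ∃ θ : ℝ, 0 < θ ∧ θ ≤ 1 ∧ ∀ j < t + 1, θ ≤ δ j := by
    have : ∀ m ≤ t + 1, ∃ θ : ℝ, 0 < θ ∧ θ ≤ 1 ∧ ∀ j < m, θ ≤ δ j := by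
      intro m
      induction m with
      | zero => exact fun _ => ⟨1, by norm_num⟩
      | succ m ih =>
        intro hm
        obtain ⟨θ, h1, h2, h3⟩ := ih (by omega)
        refine ⟨min θ (δ m), lt_min h1 (hδ m (by omega)), (min_le_left _ _).trans h2, ?_⟩
        intro j hj
        rcases Nat.lt_succ_iff_lt_or_eq.1 hj with hj | rfl
        · exact (min_le_left _ _).trans (h3 j hj)
        · exact min_le_right _ _
    exact this _ le_rfl
  have hdisj : ∀ᶠ i in hyperfilter ℕ, ∀ a ∈ Finset.range (t + 1), ∀ b ∈ Finset.range (t + 1),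
      a < b → Disjoint (A a i) (A b i) := by
    simp only [Filter.eventually_all_finset]
    intro a ha b hb
    rw [Finset.mem_range] at ha hb
    by_cases hab : a < b
    · have h1 := hd a b hab hb
      rw [← hAC a ha, ← hAC b hb, Set.disjoint_iff_inter_eq_empty, ← st_inter,
        ← Set.subset_empty_iff] at h1
      have h2 : st (fun i => A a i ∩ A b i) ⊆ st fun _ => ∅ := h1.trans (Set.empty_subset _)
      filter_upwards [st_subset_iff.1 h2] with i hi _
      exact Set.disjoint_iff_inter_eq_empty.2 (Set.subset_empty_iff.1 hi)
    · exact Eventually.of_forall fun i hi => (hab hi).elim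
  have hsize : ∀ᶠ i in hyperfilter ℕ, ∀ a ∈ Finset.range (t + 1),
      δ a * Nat.card (V i) ≤ (A a i).ncard := by
    simp only [Filter.eventually_all_finset]
    exact fun a ha => hA a (Finset.mem_range.1 ha)
  have key : ∀ᶠ i in hyperfilter ℕ, ∃ x ∈ A 0 i,
      1 / ((i : ℝ) + 1) * N i ^ t ≤ (layer (G i) (fun j => A j i) {x} t).ncard := by
    filter_upwards [hdisj, hsize, eventually_inv_le one_pos,
      eventually_inv_le (δ := θ / 4) (by positivity),
      eventually_inv_le (δ := (θ / 16) ^ t) (by positivity)] with i h1 h2 h3 h4 h5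
    refine (h.noPair i).exists_large_layer (h.one_le i) (by positivity) h3 hθ1 h4 h5 (fun j => A j i) ?_ ?_
    · intro j hj
      rw [← h.card_eq]
      refine le_trans ?_ (h2 j (Finset.mem_range.2 (by omega)))
      gcongr
      exact hθδ j (by omega)
    · intro a b hab hb
      exact h1 a (Finset.mem_range.2 (by omega)) b (Finset.mem_range.2 (by omega)) hab
  have key' : ∀ i, ∃ x, (∃ x ∈ A 0 i,
      1 / ((i : ℝ) + 1) * N i ^ t ≤ (layer (G i) (fun j => A j i) {x} t).ncard) → x ∈ A 0 i ∧
      1 / ((i : ℝ) + 1) * N i ^ t ≤ (layer (G i) (fun j => A j i) {x} t).ncard := by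
    intro i
    by_cases h1 : ∃ x ∈ A 0 i,
      1 / ((i : ℝ) + 1) * N i ^ t ≤ (layer (G i) (fun j => A j i) {x} t).ncard
    · obtain ⟨x, hx⟩ := h1
      exact ⟨x, fun _ => hx⟩
    · exact ⟨Classical.arbitrary _, fun h => (h1 h).elim⟩
  choose x hx using key'
  refine ⟨x, ?_, ?_⟩
  · rw [← hAC 0 (by omega)]
    exact key.mono fun i hi => (hx i hi).1
  · rintro D ⟨B, rfl, η, hη, hB⟩
    rw [nbhd_layer (fun j hj => hAC j (by omega)), ← st_inter]
    exact isBig_st.2 ⟨η / 4, by positivity,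
      h.nbhd_inter hη (key.mono fun i hi => (hx i hi).2) hB⟩

/-- The ultraproduct of a coherent sequence is a limit. -/
def toLimit : Limit (limitGraph G) (t + 1) where
  Int S := ∃ A, st A = S
  Big := IsBig
  int_of_big := fun ⟨A, hA, _⟩ => ⟨A, hA⟩
  int_inter := by rintro _ _ ⟨A, rfl⟩ ⟨B, rfl⟩; exact ⟨_, st_inter A B⟩
  int_union := by rintro _ _ ⟨A, rfl⟩ ⟨B, rfl⟩; exact ⟨_, st_union A B⟩
  int_diff := by rintro _ _ ⟨A, rfl⟩ ⟨B, rfl⟩; exact ⟨_, st_diff A B⟩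
  int_nbhd := by rintro _ ⟨A, rfl⟩; exact ⟨_, st_nbhd A⟩
  int_nbhd_singleton x := ⟨_, (st_nbhd_singleton x).symm⟩
  big_mono := by
    rintro _ _ ⟨A, rfl, δ, hδ, hA⟩ ⟨B, rfl⟩ hAB
    refine isBig_st.2 ⟨δ, hδ, ?_⟩
    filter_upwards [hA, st_subset_iff.1 hAB] with i h1 h2
    exact h1.trans (by exact_mod_cast Set.ncard_le_ncard h2)
  big_or := by
    rintro _ _ ⟨A, rfl⟩ ⟨B, rfl⟩ hAB
    rw [← st_union, isBig_st] at hAB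
    obtain ⟨δ, hδ, hAB⟩ := hAB
    have : ∀ᶠ i in hyperfilter ℕ, δ / 2 * Nat.card (V i) ≤ (A i).ncard ∨
        δ / 2 * Nat.card (V i) ≤ (B i).ncard := by
      filter_upwards [hAB] with i h1
      by_contra! h2
      have h3 : ((A i ∪ B i).ncard : ℝ) ≤ (A i).ncard + (B i).ncard := by
        exact_mod_cast Set.ncard_union_le _ _
      linarith [h2.1, h2.2]
    exact (Ultrafilter.eventually_or.1 this).imp
      (fun h1 => isBig_st.2 ⟨δ / 2, by positivity, h1⟩)
      (fun h1 => isBig_st.2 ⟨δ / 2, by positivity, h1⟩)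
  big_univ := by
    have h1 : st (fun i => (Set.univ : Set (V i))) = Set.univ := by simp [st]
    rw [← h1]
    exact isBig_st.2 ⟨1, one_pos, by simp [Set.ncard_univ]⟩
  big_split := by
    rintro _ ⟨A, rfl, hA⟩
    exact h.split (isBig_st.2 hA)
  not_big_nbhd x := by
    rw [st_nbhd_singleton, isBig_st]
    rintro ⟨δ, hδ, h1⟩
    obtain ⟨i, h2, h3⟩ := (h1.and (eventually_inv_le hδ)).exists
    have h4 : 1 / ((i : ℝ) + 1) * Nat.card (V i) ≤ δ * Nat.card (V i) := by gcongr
    linarith [h.degree i (x i)]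
  big_nbhd_inter := by
    rintro _ _ ⟨A, rfl, δ, hδ, hA⟩ ⟨B, rfl, η, hη, hB⟩
    rw [← st_nbhd, ← st_inter]
    refine isBig_st.2 ⟨η / 4, by positivity, h.nbhd_inter hη ?_ hB⟩
    filter_upwards [hA, eventually_inv_le hδ] with i h1 h2
    have h0 := h.one_le i
    refine le_trans ?_ h1
    rw [h.card_eq]
    gcongr
    omega
  race := by
    rintro _ _ ⟨A, rfl⟩ hAB ⟨B, rfl⟩
    exact h.race hAB
  expand := h.expand

end CoherentSeq

end Ultraproduct

/-! ### From the ultraproduct back to finite sparse graphs -/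

section Sparse

open Filter

universe u

/-- The pattern is a finite list of adjacencies and non-adjacencies, so it holds at almost every
index. It does not mention injectivity, so sequences that agree almost everywhere need not be
identified. -/
theorem IsCycleSeq.exists_of_limitGraph {V : ℕ → Type u} {G : ∀ i, SimpleGraph (V i)} {ℓ : ℕ}
    {f : ℕ → ∀ i, V i} (h : IsCycleSeq (limitGraph G) ℓ f) :
    ∃ i f, IsCycleSeq (G i) ℓ f := by
  have key : ∀ᶠ n in hyperfilter ℕ, ∀ i ∈ Finset.range ℓ, ∀ j ∈ Finset.range ℓ, i < j →
      ((G n).Adj (f i n) (f j n) ↔ j = i + 1 ∨ (i = 0 ∧ j + 1 = ℓ)) := by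
    simp only [Filter.eventually_all_finset]
    intro i _ j hj
    by_cases hij : i < j
    · have h1 := h i j hij (Finset.mem_range.1 hj)
      by_cases hP : j = i + 1 ∨ (i = 0 ∧ j + 1 = ℓ)
      · have h2 : ∀ᶠ n in hyperfilter ℕ, (G n).Adj (f i n) (f j n) := h1.2 hP
        filter_upwards [h2] with n hn _ using iff_of_true hn hP
      · have h2 : ¬ ∀ᶠ n in hyperfilter ℕ, (G n).Adj (f i n) (f j n) := fun h3 => hP (h1.1 h3)
        filter_upwards [Ultrafilter.eventually_not.2 h2] with n hn _ using iff_of_false hn hP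
    · exact Eventually.of_forall fun n hn => (hij hn).elim
  obtain ⟨n, hn⟩ := key.exists
  exact ⟨n, fun i => f i n, fun i j hij hj =>
    hn i (Finset.mem_range.2 (by omega)) j (Finset.mem_range.2 hj) hij⟩

/-- A sparse graph without an induced cycle of a given large length has a large anticomplete
pair. -/
theorem exists_not_noPair_of_sparse (t ℓ : ℕ) (hℓ : 4 * (t + 1) + 5 ≤ ℓ) :
    ∃ ε : ℝ, 0 < ε ∧ ∀ (V : Type u) [Finite V] (G : SimpleGraph V) (N : ℝ), 1 ≤ N →
      (Nat.card V : ℝ) = N ^ (t + 1) → 2 ≤ Nat.card V →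
      (∀ x, ((nbhd G {x}).ncard : ℝ) < ε * Nat.card V) → (¬ ∃ f, IsCycleSeq G ℓ f) →
      ¬ NoPair G (ε * N ^ (t + 1)) (ε * N ^ t) := by
  by_contra! hcon
  have hcon' := fun i : ℕ => hcon (1 / ((i : ℝ) + 1)) (by positivity)
  choose V hV G N hN hcard h2 hdeg hcyc hpair using hcon'
  -- With at most i vertices all degrees would be below 1, so there would be no edges, and one
  -- vertex against the rest would contradict `hpair`.
  have hlt : ∀ i, i < Nat.card (V i) := by
    intro i
    by_contra! hle
    have hi : (Nat.card (V i) : ℝ) ≤ i := by exact_mod_cast hle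
    have hpos : (0 : ℝ) < (i : ℝ) + 1 := by positivity
    have h2' : (2 : ℝ) ≤ Nat.card (V i) := by exact_mod_cast h2 i
    have hedge : ∀ x y, ¬ (G i).Adj x y := by
      intro x y hxy
      have h3 := hdeg i x
      have h4 : 1 ≤ (nbhd (G i) {x}).ncard :=
        (Set.ncard_pos (Set.toFinite _)).2 ⟨y, mem_nbhd_singleton.2 hxy⟩
      have h5 : (1 : ℝ) ≤ (nbhd (G i) {x}).ncard := by exact_mod_cast h4
      have h6 : 1 / ((i : ℝ) + 1) * Nat.card (V i) ≤ 1 := by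
        rw [one_div, inv_mul_le_iff₀ hpos]; linarith
      linarith
    have hne : Nonempty (V i) := (Nat.card_pos_iff.1 (by have := h2 i; omega)).1
    obtain ⟨v⟩ := hne
    obtain ⟨x, -, y, -, hxy⟩ := hpair i {v}ᶜ {v} disjoint_compl_left (by
      have h3 : ({v}ᶜ : Set (V i)).ncard + 1 = Nat.card (V i) := by
        rw [← Set.ncard_add_ncard_compl {v}, Set.ncard_singleton, add_comm]
      have h4 : (({v}ᶜ : Set (V i)).ncard : ℝ) + 1 = Nat.card (V i) := by exact_mod_cast h3
      rw [← hcard, one_div, inv_mul_le_iff₀ hpos]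
      nlinarith) (by
      rw [Set.ncard_singleton, Nat.cast_one, one_div, inv_mul_le_iff₀ hpos]
      have : N i ^ t ≤ N i ^ (t + 1) := pow_le_pow_right₀ (hN i) (by omega)
      rw [← hcard] at this
      linarith)
    exact hedge x y hxy
  have hne : ∀ i, Nonempty (V i) := fun i =>
    (Nat.card_pos_iff.1 (by have := h2 i; omega)).1
  have hseq : CoherentSeq G t N := ⟨hN, hcard, hlt, hdeg, hpair⟩
  obtain ⟨f, hf⟩ := hseq.toLimit.exists_isCycleSeq (by omega) hℓ
  obtain ⟨i, g, hg⟩ := hf.exists_of_limitGraph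
  exact hcyc i g hg

end Sparse

/-! ### Sparse or dense linear-sized subsets in graphs without a given induced subgraph -/

section Rodl

open Classical Finset

/-- A pattern of adjacencies either embeds transversally in a sequence of sets, or there are large
subsets of two of the sets with extreme density between them. -/
theorem exists_pattern_or_pair {η : ℝ} (hη : 0 < η) (hη1 : η ≤ 1) (h : ℕ) :
    ∃ δ : ℝ, 0 < δ ∧ δ ≤ 1 ∧ ∀ (P : ℕ → ℕ → Prop) {V : Type*} [Nonempty V] (G : SimpleGraph V)
      (S : ℕ → Finset V) (M : ℝ), 0 < M → (∀ i < h, M ≤ (S i).card) →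
      (∃ f : ℕ → V, (∀ i < h, f i ∈ S i) ∧ ∀ i j, i < j → j < h → (G.Adj (f i) (f j) ↔ P i j)) ∨
      ∃ i j, i < j ∧ j < h ∧ ∃ A ⊆ S i, ∃ B ⊆ S j, δ * M ≤ A.card ∧ δ * M ≤ B.card ∧
        ((∀ a ∈ A, ((B.filter fun b => G.Adj a b).card : ℝ) ≤ η * B.card) ∨
          ∀ a ∈ A, ((B.filter fun b => ¬ G.Adj a b).card : ℝ) ≤ η * B.card) := by
  induction h with
  | zero =>
    exact ⟨1, one_pos, le_rfl, fun P V _ G S M _ _ =>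
      Or.inl ⟨fun _ => Classical.arbitrary V, by simp, by simp⟩⟩
  | succ h ih =>
    obtain ⟨δ, hδ, hδ1, ih⟩ := ih
    have hh : (0 : ℝ) < (h : ℝ) + 1 := by positivity
    refine ⟨min (δ * η) (1 / ((h : ℝ) + 1)), by positivity,
      (min_le_left _ _).trans (mul_le_one₀ hδ1 hη.le hη1), fun P V _ G S M hM hS => ?_⟩
    let nb : V → ℕ → Finset V := fun a j =>
      (S (j + 1)).filter fun b => G.Adj a b ↔ P 0 (j + 1)
    -- Greedy embedding: a vertex with the right adjacency to an η-proportion of every later set is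
    -- taken as `f 0`, and those sets shrink. If none exists, by pigeonhole many vertices of `S 0`
    -- fail at the same later set, which is an extreme pair.
    by_cases hgood : ∃ a ∈ S 0, ∀ j < h, η * M ≤ (nb a j).card
    · obtain ⟨a, ha, hgood⟩ := hgood
      rcases ih (fun i j => P (i + 1) (j + 1)) G (nb a) (η * M) (by positivity) hgood with h1 | h1
      · obtain ⟨f, hf, hfP⟩ := h1
        refine Or.inl ⟨fun i => i.casesOn a f, ?_, ?_⟩
        · rintro (_ | i) hi
          · exact ha
          · exact (mem_filter.1 (hf i (by omega))).1
        · rintro (_ | i) (_ | j) hij hj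
          · omega
          · exact (mem_filter.1 (hf j (by omega))).2
          · omega
          · exact hfP i j (by omega) (by omega)
      · obtain ⟨i, j, hij, hj, A, hA, B, hB, hAc, hBc, hAB⟩ := h1
        have h2 : min (δ * η) (1 / ((h : ℝ) + 1)) * M ≤ δ * (η * M) := by
          rw [← mul_assoc]; gcongr; exact min_le_left _ _
        exact Or.inr ⟨i + 1, j + 1, by omega, by omega, A, hA.trans (filter_subset _ _), B,
          hB.trans (filter_subset _ _), h2.trans hAc, h2.trans hBc, hAB⟩
    · push Not at hgood
      have h1 : S 0 ⊆ (range h).biUnion fun j => (S 0).filter fun a => (nb a j).card < η * M := by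
        intro a ha
        obtain ⟨j, hj, hja⟩ := hgood a ha
        exact mem_biUnion.2 ⟨j, mem_range.2 hj, mem_filter.2 ⟨ha, hja⟩⟩
      obtain ⟨j, hj, hcard⟩ : ∃ j < h,
          M / ((h : ℝ) + 1) ≤ ((S 0).filter fun a => (nb a j).card < η * M).card := by
        by_contra! hcon
        have h2 := (card_le_card h1).trans card_biUnion_le
        have h3 : ((S 0).card : ℝ) ≤ ∑ j ∈ range h,
            (((S 0).filter fun a => (nb a j).card < η * M).card : ℝ) := by exact_mod_cast h2
        have h4 : ∑ j ∈ range h, (((S 0).filter fun a => (nb a j).card < η * M).card : ℝ) ≤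
            ∑ j ∈ range h, M / ((h : ℝ) + 1) :=
          sum_le_sum fun j hj => (hcon j (mem_range.1 hj)).le
        rw [sum_const, card_range, nsmul_eq_mul] at h4
        have h5 := hS 0 (by omega)
        have h6 : (h : ℝ) * (M / ((h : ℝ) + 1)) < M := by
          rw [← mul_div_assoc, div_lt_iff₀ hh]; nlinarith
        linarith
      have hSj := hS (j + 1) (by omega)
      refine Or.inr ⟨0, j + 1, by omega, by omega, _, filter_subset _ _, S (j + 1), subset_rfl,
        le_trans ?_ hcard, le_trans ?_ hSj, ?_⟩
      · calc min (δ * η) (1 / ((h : ℝ) + 1)) * M ≤ 1 / ((h : ℝ) + 1) * M := by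
              gcongr; exact min_le_right _ _
          _ = M / ((h : ℝ) + 1) := by ring
      · refine mul_le_of_le_one_left hM.le ((min_le_left _ _).trans (mul_le_one₀ hδ1 hη.le hη1))
      · have hle : η * M ≤ η * (S (j + 1)).card := by gcongr
        by_cases hP : P 0 (j + 1)
        · refine Or.inl fun a ha => ?_
          have h2 := (mem_filter.1 ha).2
          simp only [nb, hP, iff_true] at h2
          exact h2.le.trans hle
        · refine Or.inr fun a ha => ?_
          have h2 := (mem_filter.1 ha).2
          simp only [nb, hP, iff_false] at h2
          exact h2.le.trans hle

theorem exists_subset_sum_le {V : Type*} {c : ℝ} {f : V → ℝ} {B : Finset V} {s : ℕ}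
    (hs : s ≤ B.card) (hB : ∑ b ∈ B, f b ≤ c * B.card) :
    ∃ B' ⊆ B, B'.card = s ∧ ∑ b ∈ B', f b ≤ c * s := by
  induction hn : B.card - s generalizing B with
  | zero =>
    obtain rfl : B.card = s := by omega
    exact ⟨B, subset_rfl, rfl, hB⟩
  | succ n ih =>
    have hpos : B.Nonempty := card_pos.1 (by omega)
    obtain ⟨b, hb, hsum⟩ : ∃ b ∈ B, ∑ x ∈ B.erase b, f x ≤ c * (B.erase b).card := by
      by_cases h : ∃ b ∈ B, c ≤ f b
      · obtain ⟨b, hb, hcb⟩ := h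
        refine ⟨b, hb, ?_⟩
        rw [← add_sum_erase _ _ hb, ← card_erase_add_one hb] at hB
        push_cast at hB
        linarith
      · push Not at h
        obtain ⟨b, hb⟩ := hpos
        refine ⟨b, hb, ?_⟩
        rw [mul_comm, ← nsmul_eq_mul]
        exact sum_le_card_nsmul _ _ _ fun x hx => (h x (mem_of_mem_erase hx)).le
    have hcard := card_erase_of_mem hb
    obtain ⟨B', hB', h1, h2⟩ := ih (by omega) hsum (by omega)
    exact ⟨B', hB'.trans (erase_subset _ _), h1, h2⟩

theorem exists_disjoint_family {V : Type*} (W : Finset V) (M h : ℕ) (hW : h * M ≤ W.card) :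
    ∃ S : ℕ → Finset V, (∀ i < h, S i ⊆ W ∧ (S i).card = M) ∧
      ∀ i j, i < j → j < h → Disjoint (S i) (S j) := by
  induction h generalizing W with
  | zero => exact ⟨fun _ => ∅, by simp, by simp⟩
  | succ h ih =>
    rw [add_mul, one_mul] at hW
    obtain ⟨T, hT, hTc⟩ := exists_subset_card_eq (s := W) (n := M) (by omega)
    obtain ⟨S, hS, hSd⟩ := ih (W \ T) (by rw [card_sdiff_of_subset hT]; omega)
    refine ⟨fun i => i.casesOn T S, ?_, ?_⟩
    · rintro (_ | i) hi
      · exact ⟨hT, hTc⟩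
      · exact ⟨(hS i (by omega)).1.trans sdiff_subset, (hS i (by omega)).2⟩
    · rintro (_ | i) (_ | j) hij hj
      · omega
      · exact disjoint_sdiff.mono_right (hS j (by omega)).1
      · omega
      · exact hSd i j (by omega) (by omega)

variable {V : Type*} {G : SimpleGraph V}

/-- The number of adjacent pairs in `A × B`. -/
noncomputable def pairSum (G : SimpleGraph V) (A B : Finset V) : ℝ :=
  ∑ a ∈ A, ((B.filter fun b => G.Adj a b).card : ℝ)

theorem pairSum_comm (A B : Finset V) : pairSum G A B = pairSum G B A := by
  simp only [pairSum, card_filter, Nat.cast_sum]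
  rw [sum_comm]
  simp only [G.adj_comm]

theorem pairSum_union_left {A A' : Finset V} (h : Disjoint A A') (B : Finset V) :
    pairSum G (A ∪ A') B = pairSum G A B + pairSum G A' B := sum_union h

theorem pairSum_le (A B : Finset V) : pairSum G A B ≤ A.card * B.card := by
  rw [← nsmul_eq_mul]
  exact sum_le_card_nsmul _ _ _ fun a _ => by exact_mod_cast card_filter_le _ _

/-- Some set of `a * s` vertices of `W` has few edges. -/
def HasSparseSet (G : SimpleGraph V) (η : ℝ) (W : Finset V) (a s : ℕ) : Prop :=
  ∃ X ⊆ W, X.card = a * s ∧ pairSum G X X ≤ (a + η * a ^ 2) * s ^ 2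

theorem HasSparseSet.mono {η : ℝ} {W W' : Finset V} {a s : ℕ} (h : HasSparseSet G η W a s)
    (hW : W ⊆ W') : HasSparseSet G η W' a s := by
  obtain ⟨X, hX, h⟩ := h
  exact ⟨X, hX.trans hW, h⟩

/-- The bound allows s² inside each block and ηs² per ordered pair of blocks. The new block is cut
from `B` by averaging, so that its density to `X` does not exceed η. -/
theorem HasSparseSet.succ {η : ℝ} (hη : 0 ≤ η) {W A B : Finset V} {a s : ℕ}
    (h : HasSparseSet G η A a s) (hAW : A ⊆ W) (hBW : B ⊆ W) (hd : Disjoint A B) (hs : s ≤ B.card)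
    (hAB : ∀ x ∈ A, ((B.filter fun b => G.Adj x b).card : ℝ) ≤ η * B.card) :
    HasSparseSet G η W (a + 1) s := by
  obtain ⟨X, hXA, hX, hXX⟩ := h
  have h1 : pairSum G B X ≤ η * X.card * B.card := by
    rw [pairSum_comm, mul_comm η, mul_assoc, ← nsmul_eq_mul]
    exact sum_le_card_nsmul _ _ _ fun x hx => hAB x (hXA hx)
  obtain ⟨B', hB', hB's, h2⟩ := exists_subset_sum_le hs h1
  have h2 : pairSum G B' X ≤ η * X.card * s := h2
  have hd' : Disjoint X B' := (hd.mono_left hXA).mono_right hB'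
  refine ⟨X ∪ B', union_subset (hXA.trans hAW) (hB'.trans hBW), ?_, ?_⟩
  · rw [card_union_of_disjoint hd', hX, hB's]; ring
  · have h3 := pairSum_le (G := G) B' B'
    rw [pairSum_union_left hd', pairSum_comm X, pairSum_comm B', pairSum_union_left hd',
      pairSum_union_left hd', pairSum_comm X B']
    rw [hX] at h2
    rw [hB's] at h3
    push_cast at h2 ⊢
    have : 0 ≤ η * (s : ℝ) ^ 2 := by positivity
    nlinarith

/-- Ramsey-type induction on a+b: an extreme pair comes from the pattern lemma, the induction
hypothesis is applied in one side with the matching target lowered by one, and a block of the other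
side is appended. The `+ 1` absorbs rounding, so bounded sets may take s = 0. -/
theorem exists_hasSparseSet {η : ℝ} (hη : 0 < η) (hη1 : η ≤ 1) {ℓ : ℕ} (hℓ : 1 ≤ ℓ) (n : ℕ) :
    ∀ a b : ℕ, a + b = n → ∃ δ : ℝ, 0 < δ ∧ δ ≤ 1 ∧ ∀ {V : Type*} (G : SimpleGraph V),
      (¬ ∃ f, IsCycleSeq G ℓ f) → ∀ W : Finset V, ∃ s ≤ W.card, δ * W.card ≤ s + 1 ∧
        (HasSparseSet G η W a s ∨ HasSparseSet Gᶜ η W b s) := by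
  obtain ⟨δ₀, hδ₀, -, key⟩ := exists_pattern_or_pair hη hη1 ℓ
  have hℓ' : (1 : ℝ) ≤ ℓ := by exact_mod_cast hℓ
  induction n with
  | zero =>
    intro a b hab
    obtain rfl : a = 0 := by omega
    refine ⟨1, one_pos, le_rfl, fun G _ W => ⟨W.card, le_rfl, by linarith, Or.inl ⟨∅, ?_⟩⟩⟩
    simp [pairSum]
  | succ n ih =>
    intro a b hab
    rcases a with _ | a
    · refine ⟨1, one_pos, le_rfl, fun G _ W => ⟨W.card, le_rfl, by linarith, Or.inl ⟨∅, ?_⟩⟩⟩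
      simp [pairSum]
    rcases b with _ | b
    · refine ⟨1, one_pos, le_rfl, fun G _ W => ⟨W.card, le_rfl, by linarith, Or.inr ⟨∅, ?_⟩⟩⟩
      simp [pairSum]
    obtain ⟨δ₁, hδ₁, hδ₁1, h₁⟩ := ih a (b + 1) (by omega)
    obtain ⟨δ₂, hδ₂, hδ₂1, h₂⟩ := ih (a + 1) b (by omega)
    have hδ0 : 0 < min (min δ₁ δ₂ * δ₀) 1 / (2 * ℓ) := by positivity
    refine ⟨min (min δ₁ δ₂ * δ₀) 1 / (2 * ℓ), hδ0, ?_, fun {V} G hG W => ?_⟩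
    · rw [div_le_one (by positivity)]
      linarith [min_le_right (min δ₁ δ₂ * δ₀) 1]
    by_cases hWc : W.card < 2 * ℓ
    · refine ⟨0, Nat.zero_le _, ?_, Or.inl ⟨∅, by simp [pairSum]⟩⟩
      have h1 : (W.card : ℝ) ≤ 2 * ℓ := by exact_mod_cast hWc.le
      rw [div_mul_eq_mul_div, div_le_iff₀ (by positivity)]
      calc min (min δ₁ δ₂ * δ₀) 1 * W.card ≤ 1 * (2 * ℓ) := by
            gcongr; exact min_le_right _ _
        _ = _ := by simp
    push Not at hWc
    have hVne : Nonempty V := (card_pos.1 (show 0 < W.card by omega)).to_type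
    have hdiv : ℓ * (W.card / ℓ) ≤ W.card := Nat.mul_div_le _ _
    have hM1 : 1 ≤ W.card / ℓ := (Nat.one_le_div_iff (by omega)).2 (by omega)
    have hM2 : (W.card : ℝ) / (2 * ℓ) ≤ (W.card / ℓ : ℕ) := by
      rw [div_le_iff₀ (by positivity)]
      have h1 : W.card ≤ (W.card / ℓ) * (2 * ℓ) := by
        have h2 := Nat.div_add_mod W.card ℓ
        have h3 := Nat.mod_lt W.card (show 0 < ℓ by omega)
        nlinarith
      exact_mod_cast h1
    obtain ⟨S, hS, hSd⟩ := exists_disjoint_family W (W.card / ℓ) ℓ hdiv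
    rcases key (fun i j => j = i + 1 ∨ (i = 0 ∧ j + 1 = ℓ)) G S (W.card / ℓ : ℕ)
      (by exact_mod_cast hM1) (fun i hi => by rw [(hS i hi).2]) with ⟨f, -, hf⟩ | h
    · exact (hG ⟨f, hf⟩).elim
    obtain ⟨i, j, hij, hj, A, hA, B, hB, hAc, hBc, hAB⟩ := h
    -- Trimming to at most `B.card` vertices ensures that a block of size s found in `A'` also fits
    -- into `B`.
    obtain ⟨A', hA'A, hA'c⟩ := exists_subset_card_eq (s := A) (n := min A.card B.card)
      (min_le_left _ _)
    have hA'W := (hA'A.trans hA).trans (hS i (by omega)).1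
    have hBW := hB.trans (hS j hj).1
    have hd : Disjoint A' B := ((hSd i j hij hj).mono_left (hA'A.trans hA)).mono_right hB
    have hA'B : A'.card ≤ B.card := by rw [hA'c]; exact min_le_right _ _
    have hA'l : δ₀ * (W.card / ℓ : ℕ) ≤ A'.card := by
      rw [hA'c, Nat.cast_min]; exact le_min hAc hBc
    have size : ∀ δ s : ℝ, min δ₁ δ₂ ≤ δ → δ * A'.card ≤ s →
        min (min δ₁ δ₂ * δ₀) 1 / (2 * ℓ) * W.card ≤ s := by
      intro δ s hδ hs
      have hδ' : 0 < δ := lt_of_lt_of_le (lt_min hδ₁ hδ₂) hδ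
      calc min (min δ₁ δ₂ * δ₀) 1 / (2 * ℓ) * W.card
          = min (min δ₁ δ₂ * δ₀) 1 * (W.card / (2 * ℓ)) := by ring
        _ ≤ (δ * δ₀) * (W.card / ℓ : ℕ) := by
          gcongr
          exact (min_le_left _ _).trans (by gcongr)
        _ = δ * (δ₀ * (W.card / ℓ : ℕ)) := by ring
        _ ≤ δ * A'.card := by gcongr
        _ ≤ s := hs
    rcases hAB with hAB | hAB
    · obtain ⟨s, hs, hs', h3⟩ := h₁ G hG A'
      refine ⟨s, hs.trans (card_le_card hA'W), size _ _ (min_le_left _ _) hs', ?_⟩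
      rcases h3 with h3 | h3
      · exact Or.inl (h3.succ hη.le hA'W hBW hd (hs.trans hA'B) fun x hx => hAB x (hA'A hx))
      · exact Or.inr (h3.mono hA'W)
    · obtain ⟨s, hs, hs', h3⟩ := h₂ G hG A'
      refine ⟨s, hs.trans (card_le_card hA'W), size _ _ (min_le_right _ _) hs', ?_⟩
      rcases h3 with h3 | h3
      · exact Or.inl (h3.mono hA'W)
      · refine Or.inr (h3.succ hη.le hA'W hBW hd (hs.trans hA'B) fun x hx => ?_)
        refine le_trans ?_ (hAB x (hA'A hx))
        refine Nat.cast_le.2 (card_le_card ?_)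
        intro b hb
        simp only [mem_filter] at hb ⊢
        exact ⟨hb.1, ((SimpleGraph.compl_adj _ _ _).1 hb.2).2⟩

/-- A set with few edges contains a large set inducing a subgraph of small maximum degree. -/
theorem exists_subset_degree_le {X : Finset V} {c : ℝ} (hc : 0 < c)
    (hX : pairSum G X X ≤ c * X.card ^ 2) : ∃ Y ⊆ X, X.card ≤ 2 * Y.card ∧
      ∀ y ∈ Y, ((Y.filter fun z => G.Adj y z).card : ℝ) ≤ 4 * c * Y.card := by
  set Y := X.filter fun y => ((X.filter fun z => G.Adj y z).card : ℝ) ≤ 2 * c * X.card with hY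
  have hYX : Y ⊆ X := filter_subset _ _
  have hcard : X.card ≤ 2 * Y.card := by
    by_contra! hlt
    have h1 : (2 * c * X.card) * (X \ Y).card ≤ pairSum G X X := by
      rw [mul_comm, ← nsmul_eq_mul]
      refine (card_nsmul_le_sum (X \ Y) (fun a => ((X.filter fun b => G.Adj a b).card : ℝ)) _
        fun x hx => ?_).trans (sum_le_sum_of_subset_of_nonneg sdiff_subset
          fun _ _ _ => Nat.cast_nonneg _)
      by_contra! h2
      exact (mem_sdiff.1 hx).2 (mem_filter.2 ⟨(mem_sdiff.1 hx).1, h2.le⟩)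
    have h2 := card_sdiff_add_card_eq_card hYX
    have h3 : X.card + 1 ≤ 2 * (X \ Y).card := by omega
    have h4 : (X.card : ℝ) + 1 ≤ 2 * (X \ Y).card := by exact_mod_cast h3
    have h5 : (0 : ℝ) < X.card := by
      have : 0 < X.card := by omega
      exact_mod_cast this
    have h6 : c * X.card * (X.card + 1) ≤ c * X.card * (2 * (X \ Y).card) := by gcongr
    have h7 : 0 < c * X.card := by positivity
    nlinarith
  refine ⟨Y, hYX, hcard, fun y hy => ?_⟩
  have h1 : (X.card : ℝ) ≤ 2 * Y.card := by exact_mod_cast hcard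
  calc ((Y.filter fun z => G.Adj y z).card : ℝ) ≤ (X.filter fun z => G.Adj y z).card := by
        exact_mod_cast card_le_card (filter_subset_filter _ hYX)
    _ ≤ 2 * c * X.card := (mem_filter.1 hy).2
    _ ≤ 2 * c * (2 * Y.card) := by gcongr
    _ = 4 * c * Y.card := by ring

/-- The subgraph induced on `Y` has maximum degree less than `ε` times the size of `Y`. -/
def IsSparseOn (G : SimpleGraph V) (ε : ℝ) (Y : Finset V) : Prop :=
  ∀ y ∈ Y, ((Y.filter fun z => G.Adj y z).card : ℝ) < ε * Y.card

/-- For K ≥ 16/ε the contribution inside blocks is no larger than the one across, so the density is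
at most ε/8; keeping the half of low degree gives degrees at most ε/2. -/
theorem HasSparseSet.exists_isSparseOn {W : Finset V} {ε : ℝ} (hε : 0 < ε) {K s : ℕ}
    (hK : 16 / ε ≤ K) (hs : 1 ≤ s) (h : HasSparseSet G (ε / 16) W K s) :
    ∃ Y : Finset V, K * s ≤ 2 * Y.card ∧ IsSparseOn G ε Y := by
  obtain ⟨X, -, hX, hXX⟩ := h
  have hK0 : (0 : ℝ) < K := lt_of_lt_of_le (by positivity) hK
  have hK1 : 0 < K := by exact_mod_cast hK0
  obtain ⟨Y, -, hY, hdeg⟩ := exists_subset_degree_le (G := G) (X := X) (c := ε / 8)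
    (by positivity) (by
      refine hXX.trans ?_
      rw [hX]
      push_cast
      rw [div_le_iff₀ hε] at hK
      have h1 : (K : ℝ) ≤ ε / 16 * K ^ 2 := by nlinarith
      have h2 : 0 ≤ (s : ℝ) ^ 2 := by positivity
      rw [mul_pow, ← mul_assoc]
      gcongr
      linarith)
  rw [hX] at hY
  refine ⟨Y, hY, fun y hy => (hdeg y hy).trans_lt ?_⟩
  have : (0 : ℝ) < Y.card := by exact_mod_cast card_pos.2 ⟨y, hy⟩
  nlinarith [mul_pos hε this]

/-- Rödl's theorem for graphs without an induced cycle of a given length. -/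
theorem exists_sparse_or_dense {ε : ℝ} (hε : 0 < ε) (hε1 : ε ≤ 1) {ℓ : ℕ} (hℓ : 1 ≤ ℓ) :
    ∃ δ : ℝ, 0 < δ ∧ δ ≤ 1 ∧ ∀ {V : Type*} [Fintype V] (G : SimpleGraph V),
      (¬ ∃ f, IsCycleSeq G ℓ f) → 1 ≤ δ * Fintype.card V →
      ∃ Y : Finset V, 2 ≤ Y.card ∧ δ * Fintype.card V ≤ Y.card ∧
        (IsSparseOn G ε Y ∨ IsSparseOn Gᶜ ε Y) := by
  obtain ⟨δ, hδ, hδ1, key⟩ := exists_hasSparseSet (η := ε / 16) (by positivity) (by linarith) hℓ _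
    ⌈16 / ε⌉₊ ⌈16 / ε⌉₊ rfl
  set K := ⌈16 / ε⌉₊ with hK
  have hK16 : 16 / ε ≤ K := Nat.le_ceil _
  have hK4 : (4 : ℝ) ≤ K := by
    refine le_trans ?_ hK16
    rw [le_div_iff₀ hε]; linarith
  refine ⟨δ / 2, by positivity, by linarith, fun {V} _ G hG hV => ?_⟩
  obtain ⟨s, -, hs, h⟩ := key G hG univ
  rw [card_univ] at hs
  have hs0 : (0 : ℝ) < s := by linarith
  have hs1 : 1 ≤ s := by exact_mod_cast hs0
  have hs1' : (1 : ℝ) ≤ s := by exact_mod_cast hs1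
  have size : ∀ Y : Finset V, K * s ≤ 2 * Y.card →
      2 ≤ Y.card ∧ δ / 2 * Fintype.card V ≤ Y.card := by
    intro Y hY
    have h1 : (K : ℝ) * s ≤ 2 * Y.card := by exact_mod_cast hY
    have h2 : 4 * (s : ℝ) ≤ K * s := by gcongr
    have h3 : (2 : ℝ) ≤ Y.card := by linarith
    exact ⟨by exact_mod_cast h3, by linarith⟩
  rcases h with h | h
  · obtain ⟨Y, hY, hdeg⟩ := h.exists_isSparseOn hε hK16 hs1
    exact ⟨Y, (size Y hY).1, (size Y hY).2, Or.inl hdeg⟩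
  · obtain ⟨Y, hY, hdeg⟩ := h.exists_isSparseOn hε hK16 hs1
    exact ⟨Y, (size Y hY).1, (size Y hY).2, Or.inr hdeg⟩

end Rodl

/-! ### Pure pairs -/

section PurePair

open Classical

universe u

/-- Injectivity follows from adjacency alone, since distinct vertices of a cycle of length at least
5 have distinct neighbourhoods. In a 4-cycle opposite vertices are twins. -/
theorem IsCycleSeq.hasHole {V : Type*} {G : SimpleGraph V} {ℓ : ℕ} (hℓ : 5 ≤ ℓ) {f : ℕ → V}
    (hf : IsCycleSeq G ℓ f) : HasHole G ℓ := by
  refine ⟨by omega, ?_⟩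
  have hadj : ∀ a b : Fin ℓ, G.Adj (f a) (f b) ↔ (SimpleGraph.cycleGraph ℓ).Adj a b := by
    have key : ∀ a b : Fin ℓ, a < b →
        (G.Adj (f a) (f b) ↔ (SimpleGraph.cycleGraph ℓ).Adj a b) := by
      intro a b hab
      rw [hf a b hab b.2, SimpleGraph.cycleGraph_adj']
      have ha := a.2
      have hb := b.2
      have hab' : a.val < b.val := hab
      rw [Fin.sub_def, Fin.sub_def]
      simp only
      rw [Nat.mod_eq_of_lt (show ℓ - b.val + a.val < ℓ by omega),
        show ℓ - a.val + b.val = ℓ + (b.val - a.val) by omega, Nat.add_mod_left,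
        Nat.mod_eq_of_lt (show b.val - a.val < ℓ by omega)]
      omega
    intro a b
    rcases lt_trichotomy a b with h | rfl | h
    · exact key a b h
    · simp
    · rw [G.adj_comm, key b a h, SimpleGraph.adj_comm]
  have hinj : Function.Injective fun a : Fin ℓ => f a := by
    have key : ∀ a b : Fin ℓ, a < b → f a ≠ f b := by
      intro a b hab hfab
      obtain ⟨a, ha⟩ := a
      obtain ⟨b, hb⟩ := b
      have hab : a < b := hab
      have hfab : f a = f b := hfab
      by_cases h1 : b = a + 1
      · have h2 := (hf a b hab hb).2 (Or.inl h1)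
        rw [hfab] at h2
        exact G.loopless.irrefl _ h2
      have h2 := (hf a (a + 1) (by omega) (by omega)).2 (Or.inl rfl)
      rw [hfab, G.adj_comm, hf (a + 1) b (by omega) hb] at h2
      by_cases h3 : b + 1 < ℓ
      · have h4 := (hf b (b + 1) (by omega) h3).2 (Or.inl rfl)
        rw [← hfab, hf a (b + 1) (by omega) h3] at h4
        omega
      · have h4 := (hf (a - 1) a (by omega) ha).2 (Or.inl (by omega))
        rw [hfab, hf (a - 1) b (by omega) hb] at h4
        omega
    intro a b hfab
    rcases lt_trichotomy a b with h | h | h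
    · exact (key a b h hfab).elim
    · exact h
    · exact (key b a h hfab.symm).elim
  exact ⟨⟨⟨fun a => f a, hinj⟩, hadj _ _⟩⟩

/-- The sparse case: pure pairs in a set inducing a sparse subgraph. -/
theorem exists_anticomplete_of_isSparseOn (t ℓ : ℕ) (hℓ : 4 * (t + 1) + 5 ≤ ℓ) :
    ∃ ε : ℝ, 0 < ε ∧ ∀ (V : Type u) (G : SimpleGraph V) (Y : Finset V), 2 ≤ Y.card →
      IsSparseOn G ε Y → ¬ HasHole G ℓ → ∃ A B : Finset V, Disjoint A B ∧ IsAnticomplete G A B ∧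
        ε * (Y.card : ℝ) ≤ A.card ∧
          ε * (Y.card : ℝ) ^ (1 - 1 / ((t : ℝ) + 1)) ≤ B.card := by
  obtain ⟨ε, hε, key⟩ := exists_not_noPair_of_sparse.{u} t ℓ hℓ
  refine ⟨ε, hε, fun V G Y hY hdeg hhole => ?_⟩
  have hcard : Nat.card Y = Y.card := by simp
  have ht : (0 : ℝ) < (t : ℝ) + 1 := by positivity
  have hY1 : (1 : ℝ) ≤ Y.card := by exact_mod_cast (by omega : 1 ≤ Y.card)
  have hN : ∀ j : ℕ, ((Y.card : ℝ) ^ (1 / ((t : ℝ) + 1))) ^ j =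
      (Y.card : ℝ) ^ ((j : ℝ) / ((t : ℝ) + 1)) := by
    intro j
    rw [← Real.rpow_natCast, ← Real.rpow_mul (by positivity)]
    congr 1
    ring
  have hN1 : ((Y.card : ℝ) ^ (1 / ((t : ℝ) + 1))) ^ (t + 1) = Y.card := by
    rw [hN]
    push_cast
    rw [div_self ht.ne', Real.rpow_one]
  have := key Y (G.induce (Y : Set V)) ((Y.card : ℝ) ^ (1 / ((t : ℝ) + 1)))
    (Real.one_le_rpow hY1 (by positivity)) (by rw [hcard, hN1]) (by rw [hcard]; exact hY) ?_ ?_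
  · rw [hN1, hN] at this
    unfold NoPair at this
    push Not at this
    obtain ⟨A, B, hAB, hA, hB, hedge⟩ := this
    refine ⟨A.toFinset.map (Function.Embedding.subtype _),
      B.toFinset.map (Function.Embedding.subtype _), ?_, ?_, ?_, ?_⟩
    · rw [Finset.disjoint_map, Set.disjoint_toFinset]
      exact hAB
    · intro a ha b hb
      simp only [Finset.mem_map, Set.mem_toFinset] at ha hb
      obtain ⟨a, ha, rfl⟩ := ha
      obtain ⟨b, hb, rfl⟩ := hb
      exact hedge a ha b hb
    · rwa [Finset.card_map, ← Set.ncard_eq_toFinset_card']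
    · rw [Finset.card_map, ← Set.ncard_eq_toFinset_card']
      convert hB using 3
      field_simp
      ring
  · intro x
    rw [hcard]
    refine lt_of_le_of_lt ?_ (hdeg x x.2)
    rw [← Set.ncard_image_of_injective _ Subtype.val_injective, ← Set.ncard_coe_finset]
    refine Nat.cast_le.2 (Set.ncard_le_ncard ?_ (Finset.finite_toSet _))
    rintro _ ⟨z, hz, rfl⟩
    have hz' : (G.induce (Y : Set V)).Adj x z := mem_nbhd_singleton.1 hz
    simpa using hz'
  · rintro ⟨f, hf⟩
    exact hhole (IsCycleSeq.hasHole (by omega) (f := fun i => (f i : V)) hf)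

end PurePair

end PurePairs

theorem mainTheorem3 (c : ℝ) (hc : 0 < c) (hint : ∃ k : ℤ, 1 / c = (k : ℝ))
    (l₁ l₂ : ℕ) (hl₁ : 4 / c + 5 ≤ (l₁ : ℝ)) (hl₂ : 4 / c + 5 ≤ (l₂ : ℝ)) :
    ∃ ε : ℝ, 0 < ε ∧
      ∀ (V : Type*) [Fintype V] (G : SimpleGraph V), 1 < Fintype.card V →
        ¬ PurePairs.HasHole G l₁ → ¬ PurePairs.HasAntihole G l₂ →
        ∃ A B : Finset V, PurePairs.IsPurePair G A B ∧
          ε * (Fintype.card V : ℝ) ≤ (A.card : ℝ) ∧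
          ε * (Fintype.card V : ℝ) ^ (1 - c) ≤ (B.card : ℝ) := by
  obtain ⟨t, ht⟩ : ∃ t : ℕ, c = 1 / ((t : ℝ) + 1) := by
    obtain ⟨k, hk⟩ := hint
    have hk0 : (0 : ℝ) < k := by rw [← hk]; positivity
    have hk1 : 0 < k := by exact_mod_cast hk0
    obtain ⟨t, rfl⟩ : ∃ t : ℕ, k = t + 1 := ⟨(k - 1).toNat, by omega⟩
    refine ⟨t, ?_⟩
    push_cast at hk
    rw [← hk, one_div_one_div]
  have htp : (0 : ℝ) < (t : ℝ) + 1 := by positivity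
  have h4 : 4 / c = 4 * ((t : ℝ) + 1) := by rw [ht]; field_simp
  rw [h4] at hl₁ hl₂
  have hl₁' : 4 * (t + 1) + 5 ≤ l₁ := by exact_mod_cast hl₁
  have hl₂' : 4 * (t + 1) + 5 ≤ l₂ := by exact_mod_cast hl₂
  obtain ⟨ε₁, hε₁, key₁⟩ := PurePairs.exists_anticomplete_of_isSparseOn t l₁ hl₁'
  obtain ⟨ε₂, hε₂, key₂⟩ := PurePairs.exists_anticomplete_of_isSparseOn t l₂ hl₂'
  obtain ⟨δ, hδ, hδ1, hrodl⟩ := PurePairs.exists_sparse_or_dense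
    (ε := min (min ε₁ ε₂) 1) (by positivity) (min_le_right _ _) (ℓ := l₁) (by omega)
  have hc0 : 0 ≤ 1 - c := by
    rw [ht, sub_nonneg, div_le_one htp]
    have : (0 : ℝ) ≤ t := by positivity
    linarith
  have hmin : ∀ {ε : ℝ}, min ε₁ ε₂ ≤ ε → min (min ε₁ ε₂) 1 ≤ ε := fun h =>
    (min_le_left _ _).trans h
  refine ⟨min (min ε₁ ε₂) 1 * δ, by positivity, fun V _ G hV h₁ h₂ => ?_⟩
  have hn : (1 : ℝ) ≤ Fintype.card V := by exact_mod_cast hV.le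
  have hpow : (Fintype.card V : ℝ) ^ (1 - c) ≤ Fintype.card V := by
    refine (Real.rpow_le_rpow_of_exponent_le hn (show 1 - c ≤ 1 by linarith)).trans ?_
    rw [Real.rpow_one]
  by_cases hsmall : 1 ≤ δ * Fintype.card V
  swap
  -- Here both required sizes are at most 1, and any two single vertices form a pure pair.
  · obtain ⟨x, y, hxy⟩ := Fintype.one_lt_card_iff.1 hV
    have hle : min (min ε₁ ε₂) 1 * δ * Fintype.card V ≤ 1 := by
      rw [mul_assoc]
      exact mul_le_one₀ (min_le_right _ _) (by positivity) (not_le.1 hsmall).le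
    refine ⟨{x}, {y}, ⟨by simpa using hxy, ?_⟩, by simpa using hle, ?_⟩
    · by_cases hadj : G.Adj x y
      · left
        simpa [SimpleGraph.IsCompleteBetween] using hadj
      · right
        simpa [PurePairs.IsAnticomplete] using hadj
    · rw [Finset.card_singleton, Nat.cast_one]
      exact le_trans (by gcongr) hle
  have transfer : ∀ (ε : ℝ) (Y : Finset V) (a b : ℕ), min ε₁ ε₂ ≤ ε →
      δ * Fintype.card V ≤ Y.card → ε * (Y.card : ℝ) ≤ a →
      ε * (Y.card : ℝ) ^ (1 - 1 / ((t : ℝ) + 1)) ≤ b →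
      min (min ε₁ ε₂) 1 * δ * (Fintype.card V : ℝ) ≤ a ∧
        min (min ε₁ ε₂) 1 * δ * (Fintype.card V : ℝ) ^ (1 - c) ≤ b := by
    intro ε Y a b hε hY ha hb
    have hε0 : 0 < ε := lt_of_lt_of_le (lt_min hε₁ hε₂) hε
    constructor
    · calc min (min ε₁ ε₂) 1 * δ * (Fintype.card V : ℝ)
          = min (min ε₁ ε₂) 1 * (δ * Fintype.card V) := by ring
        _ ≤ ε * Y.card := by gcongr; exact hmin hε
        _ ≤ a := ha
    · have hδc : δ ≤ δ ^ (1 - c) := by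
        conv_lhs => rw [← Real.rpow_one δ]
        exact Real.rpow_le_rpow_of_exponent_ge hδ hδ1 (by linarith)
      calc min (min ε₁ ε₂) 1 * δ * (Fintype.card V : ℝ) ^ (1 - c)
          ≤ ε * δ ^ (1 - c) * (Fintype.card V : ℝ) ^ (1 - c) := by gcongr; exact hmin hε
        _ = ε * (δ * Fintype.card V) ^ (1 - c) := by
          rw [Real.mul_rpow hδ.le (by positivity), mul_assoc]
        _ ≤ ε * (Y.card : ℝ) ^ (1 - c) := by gcongr
        _ ≤ b := by rw [ht]; exact hb
  obtain ⟨Y, hY2, hYδ, hY⟩ := hrodl G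
    (fun ⟨f, hf⟩ => h₁ (PurePairs.IsCycleSeq.hasHole (by omega) hf)) hsmall
  have mono : ∀ {H : SimpleGraph V} {ε : ℝ}, min ε₁ ε₂ ≤ ε →
      PurePairs.IsSparseOn H (min (min ε₁ ε₂) 1) Y → PurePairs.IsSparseOn H ε Y :=
    fun hε h y hy => (h y hy).trans_le (by gcongr; exact hmin hε)
  rcases hY with hY | hY
  · obtain ⟨A, B, hAB, hanti, hA, hB⟩ := key₁ V G Y hY2 (mono (min_le_left _ _) hY) h₁
    exact ⟨A, B, ⟨hAB, Or.inr hanti⟩, transfer _ Y _ _ (min_le_left _ _) hYδ hA hB⟩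
  · obtain ⟨A, B, hAB, hanti, hA, hB⟩ := key₂ V Gᶜ Y hY2 (mono (min_le_right _ _) hY) h₂
    refine ⟨A, B, ⟨hAB, Or.inl ?_⟩, transfer _ Y _ _ (min_le_right _ _) hYδ hA hB⟩
    intro a ha b hb
    by_contra hadj
    exact hanti a ha b hb ((SimpleGraph.compl_adj _ _ _).2
      ⟨fun hab => Finset.disjoint_left.1 hAB ha (hab ▸ hb), hadj⟩)
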